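/- Let $\mu>0$, $g>0$, $T>0$, $e_3=(0,0,1)$, and let $\bar\rho\in C^\infty(\mathbb{R})$ satisfy $\bar\rho'\in C_0^\infty(\mathbb{R})$, $\inf_{\mathbb{R}}\bar\rho>0$ and $\bar\rho'(x_3^0)>0$ for some $x_3^0\in\mathbb{R}$. Consider on $(0,T)\times\mathbb{R}^3$ the linearized equations $$\varrho_t+\bar\rho'(x_3)\,u_3=0,\qquad \bar\rho(x_3)\,\mathbf{u}_t+\nabla q+g\varrho e_3=\mu\Delta\mathbf{u},\qquad \operatorname{div}\mathbf{u}=0. \tag{1}$$ With $L^2=L^2(\mathbb{R}^3)$ and $H^m=H^m(\mathbb{R}^3)$, let $\mathcal{Q}(T)$ be the set of all $(\varrho,\mathbf{u},q)$ such that $\varrho\in C^0([0,T],L^2)$, $\nabla q\in L^2(0,T;H^1_{\mathrm{loc}})$, $\mathbf{u}\in C^0([0,T],(L^2)^3)\cap L^2(0,T;(H^2)^3)$ and $\partial_t\mathbf{u}\in (L^2((0,T)\times\mathbb{R}^3))^3$, where the derivatives are weak derivatives. A strong solution of (1) is an element of $\mathcal{Q}(T)$ that satisfies (1) almost everywhere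 in $(0,T)\times\mathbb{R}^3$, with weak derivatives. **Theorem.** Let $(\varrho_1,\mathbf{u}_1,q_1)$ and $(\varrho_2,\mathbf{u}_2,q_2)$ in $\mathcal{Q}(T)$ be two strong solutions of (1) with $(\varrho_1,\mathbf{u}_1)(0)=(\varrho_2,\mathbf{u}_2)(0)$ in $L^2\times(L^2)^3$. Then $\varrho_1(t)=\varrho_2(t)$ and $\mathbf{u}_1(t)=\mathbf{u}_2(t)$ in $L^2$ for every $t\in[0,T]$, and $\nabla q_1=\nabla q_2$ almost everywhere in $(0,T)\times\mathbb{R}^3$. -/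

import Mathlib

open MeasureTheory Set Filter Topology
open scoped ContDiff

namespace LinearizedNS

/-- Physical space `ℝ³`; the vertical coordinate `x₃` of `x` is `x 2`. -/
abbrev E3 : Type := EuclideanSpace ℝ (Fin 3)

/-- Lebesgue measure on the open slab `(0,T) × ℝ³`. -/
noncomputable def slabMeasure (T : ℝ) : Measure (ℝ × E3) :=
  (volume.restrict (Ioo 0 T)).prod volume

/-- `g` is the weak partial derivative `∂ᵢ f` on `ℝ³`, both functions being locally integrable. -/
def HasWeakPartial (i : Fin 3) (f g : E3 → ℝ) : Prop :=
  LocallyIntegrable f volume ∧ LocallyIntegrable g volume ∧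
  ∀ φ : E3 → ℝ, ContDiff ℝ ∞ φ → HasCompactSupport φ →
    ∫ x, f x * fderiv ℝ φ x (EuclideanSpace.single i 1) = - ∫ x, g x * φ x

/-- `g` is the weak space derivative `∂ᵢ f` of the function `f` on `(0,T) × ℝ³`: it is measurable
in `(t,x)`, and `g(t,·)` is the weak derivative of `f(t,·)` for almost every `t ∈ (0,T)`. -/
def HasWeakSpaceDeriv (T : ℝ) (i : Fin 3) (f g : ℝ → E3 → ℝ) : Prop :=
  AEStronglyMeasurable (Function.uncurry g) (slabMeasure T) ∧
  ∀ᵐ t ∂(volume.restrict (Ioo 0 T)), HasWeakPartial i (f t) (g t)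

/-- `g` is the weak derivative `∂ᵢ ∂ᵢ f` on `(0,T) × ℝ³`. -/
def HasWeakSecondDeriv (T : ℝ) (i : Fin 3) (f g : ℝ → E3 → ℝ) : Prop :=
  ∃ d : ℝ → E3 → ℝ, HasWeakSpaceDeriv T i f d ∧ HasWeakSpaceDeriv T i d g

/-- `g` is the weak (distributional) time derivative `∂ₜ f` on `(0,T) × ℝ³`, both functions being
locally integrable there. -/
def HasWeakTimeDeriv (T : ℝ) (f g : ℝ → E3 → ℝ) : Prop :=
  LocallyIntegrableOn (Function.uncurry f) (Ioo 0 T ×ˢ univ) volume ∧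
  LocallyIntegrableOn (Function.uncurry g) (Ioo 0 T ×ˢ univ) volume ∧
  ∀ ψ : ℝ × E3 → ℝ, ContDiff ℝ ∞ ψ → HasCompactSupport ψ → tsupport ψ ⊆ Ioo 0 T ×ˢ univ →
    ∫ p, f p.1 p.2 * fderiv ℝ ψ p (1, 0) ∂(slabMeasure T)
      = - ∫ p, g p.1 p.2 * ψ p ∂(slabMeasure T)

/-- `f ∈ C⁰([0,T], L²(ℝ³))`, `f` being a representative that is measurable in `(t,x)`. -/
def MemC0L2 {F : Type*} [NormedAddCommGroup F] (T : ℝ) (f : ℝ → E3 → F) : Prop :=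
  AEStronglyMeasurable (Function.uncurry f) (slabMeasure T) ∧
  (∀ t ∈ Icc 0 T, MemLp (f t) 2 volume) ∧
  ∀ t ∈ Icc 0 T, Tendsto (fun s => eLpNorm (f s - f t) 2 volume) (𝓝[Icc 0 T] t) (𝓝 0)

/-- `f ∈ L²((0,T) × ℝ³)`. -/
def MemL2 (T : ℝ) (f : ℝ → E3 → ℝ) : Prop :=
  MemLp (Function.uncurry f) 2 (slabMeasure T)

/-- `f ∈ L²(0,T; Hᵐ(ℝ³))`. -/
def MemL2H (T : ℝ) : ℕ → (ℝ → E3 → ℝ) → Prop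
  | 0, f => MemL2 T f
  | m + 1, f => MemL2 T f ∧ ∀ i, ∃ d, HasWeakSpaceDeriv T i f d ∧ MemL2H T m d

/-- `f ∈ L²(0,T; L²_loc(ℝ³))`, i.e. `f ∈ L²((0,T) × B_R)` for every ball. -/
def MemL2L2loc (T : ℝ) (f : ℝ → E3 → ℝ) : Prop :=
  ∀ R : ℝ, MemLp (Function.uncurry f) 2
    ((volume.restrict (Ioo 0 T)).prod (volume.restrict (Metric.ball (0 : E3) R)))

/-- `f ∈ L²(0,T; H¹_loc(ℝ³))`. -/
def MemL2H1loc (T : ℝ) (f : ℝ → E3 → ℝ) : Prop :=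
  MemL2L2loc T f ∧ ∀ i, ∃ d, HasWeakSpaceDeriv T i f d ∧ MemL2L2loc T d

/-- The `k`-th component of a time-dependent vector field. -/
def comp (u : ℝ → E3 → E3) (k : Fin 3) : ℝ → E3 → ℝ := fun t x => u t x k

/-- The function space of strong solutions on `[0,T]`: `ϱ ∈ C⁰([0,T],L²)`,
`∇q ∈ L²(0,T;H¹_loc)`, `u ∈ C⁰([0,T],(L²)³) ∩ L²(0,T;(H²)³)`, `∂ₜu ∈ (L²((0,T) × ℝ³))³`. -/
structure MemClass (T : ℝ) (ϱ : ℝ → E3 → ℝ) (u : ℝ → E3 → E3) (q : ℝ → E3 → ℝ) : Prop where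
  density : MemC0L2 T ϱ
  pressure : ∀ i, ∃ G, HasWeakSpaceDeriv T i q G ∧ MemL2H1loc T G
  velocity : MemC0L2 T u
  velocity_H2 : ∀ k, MemL2H T 2 (comp u k)
  velocity_time : ∀ k, ∃ w, HasWeakTimeDeriv T (comp u k) w ∧ MemL2 T w

/-- `(ϱ,u,q)` is a strong solution on `(0,T) × ℝ³` of
`ϱₜ + ρ'(x₃) u₃ = 0`, `ρ(x₃) uₜ + ∇q + g ϱ e₃ = μ Δu`, `div u = 0`:
it lies in the space of strong solutions, and the equations hold almost everywhere. -/
structure IsStrongSolution (ρ : ℝ → ℝ) (μ g T : ℝ)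
    (ϱ : ℝ → E3 → ℝ) (u : ℝ → E3 → E3) (q : ℝ → E3 → ℝ) : Prop where
  memClass : MemClass T ϱ u q
  mass : ∃ r, HasWeakTimeDeriv T ϱ r ∧
    ∀ᵐ p ∂(slabMeasure T), r p.1 p.2 + deriv ρ (p.2 2) * u p.1 p.2 2 = 0
  momentum : ∀ k : Fin 3, ∃ (w G : ℝ → E3 → ℝ) (D : Fin 3 → ℝ → E3 → ℝ),
    HasWeakTimeDeriv T (comp u k) w ∧ HasWeakSpaceDeriv T k q G ∧
    (∀ i, HasWeakSecondDeriv T i (comp u k) (D i)) ∧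
    ∀ᵐ p ∂(slabMeasure T),
      ρ (p.2 2) * w p.1 p.2 + G p.1 p.2
          + g * ϱ p.1 p.2 * (EuclideanSpace.single 2 1 : E3) k
        = μ * ∑ i, D i p.1 p.2
  incompressible : ∃ D : Fin 3 → ℝ → E3 → ℝ,
    (∀ k, HasWeakSpaceDeriv T k (comp u k) (D k)) ∧
    ∀ᵐ p ∂(slabMeasure T), ∑ k, D k p.1 p.2 = 0

/-- The steady density profile `ρ ∈ C^∞(ℝ)`: `ρ' ∈ C_0^∞(ℝ)`, `inf ρ > 0`, and `ρ'` is positive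
at some point. -/
structure IsSteadyProfile (ρ : ℝ → ℝ) : Prop where
  smooth : ContDiff ℝ ∞ ρ
  compact_deriv : HasCompactSupport (deriv ρ)
  inf_pos : ∃ c > 0, ∀ s, c ≤ ρ s
  deriv_pos : ∃ s, 0 < deriv ρ s

end LinearizedNS

/-! The system is linear, so the difference of the two solutions solves it with zero initial values,
and an energy estimate applies. Testing momentum with the velocity `v` and mass with `ϱ` makes the
pressure term vanish and gives the viscous term a sign. With `E = ∫ ρ |v|² + ∫ ϱ²`, what remains is
`-2 ∫ (g + ρ') ϱ v₃`, bounded by `K E` because `ρ` is bounded below by a positive constant and `ρ'`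
is bounded. Grönwall's inequality (`eq_zero_of_le_const_mul_integral`) gives `E = 0`, and the
momentum equation then forces `∇q = 0`.

The work lies in justifying this for weak derivatives.

Space: no cutoff functions are used. The correlation `corr f g y = ∫ f(x+y) g(x) dx` of two `L²`
functions is continuous and vanishes at infinity, and a weak derivative of `corr f g` may be placed
on either factor. Evaluation at `y = 0` gives integration by parts
(`HasWeakPartial.integral_mul_eq_neg`). For the pressure, `q` need not lie in `L²`, but the momentum
equation puts `∇q` there. The sum over `k` of the correlations of `∂ₖq` and `vₖ` has zero derivative
in one direction, since `∇q` is curl free and `v` is divergence free; vanishing at infinity, it is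
zero (`sum_integral_gradient_mul_eq_zero`).

Time: testing the distributional time derivative with products `η(t) φ(x)` shows that `f(t,x)` is
the time integral of `∂ₜf` (`ae_eq_integral_of_hasWeakTimeDeriv`). For almost every `x` this is an
absolutely continuous function of `t`, so its square can be differentiated; integration in `x`
yields the energy identity `integral_weight_mul_sq_eq`. -/

namespace LinearizedNS

/-! ### Correlations of square integrable functions -/

/-- The cross-correlation `y ↦ ∫ f(x + y) g(x) dx`. -/
noncomputable def corr (f g : E3 → ℝ) (y : E3) : ℝ := ∫ x, f (x + y) * g x

lemma memLp_comp_add {f : E3 → ℝ} (hf : MemLp f 2 volume) (y : E3) :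
    MemLp (fun x => f (x + y)) 2 volume :=
  hf.comp_measurePreserving (measurePreserving_add_right volume y)

/-- Translation acts continuously on `L²`, and `corr` is an inner product with a translate. -/
lemma continuous_corr {f g : E3 → ℝ} (hf : MemLp f 2 volume) (hg : MemLp g 2 volume) :
    Continuous (corr f g) := by
  let τ : E3 → C(E3, E3) := fun y => ⟨fun x => x + y, by fun_prop⟩
  have hτ : Continuous τ :=
    ContinuousMap.continuous_of_continuous_uncurry _ (by
      change Continuous fun p : E3 × E3 => p.2 + p.1
      fun_prop)
  have hmp : ∀ y, MeasurePreserving (τ y) (volume : Measure E3) volume := fun y =>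
    measurePreserving_add_right volume y
  have hc : Continuous fun y => Lp.compMeasurePreserving (τ y) (hmp y) (hf.toLp f) :=
    Continuous.compMeasurePreservingLp continuous_const hτ hmp (by simp)
  have hin : Continuous fun y =>
      inner ℝ (Lp.compMeasurePreserving (τ y) (hmp y) (hf.toLp f)) (hg.toLp g) :=
    hc.inner continuous_const
  convert hin using 2 with y
  rw [L2.inner_def, corr]
  refine integral_congr_ae ?_
  have h1 : Lp.compMeasurePreserving (τ y) (hmp y) (hf.toLp f) =ᵐ[volume] f ∘ τ y :=
    (Lp.coeFn_compMeasurePreserving _ _).trans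
      ((hmp y).quasiMeasurePreserving.ae_eq hf.coeFn_toLp)
  filter_upwards [h1, hg.coeFn_toLp] with x hx hx'
  rw [hx, hx']
  simp [τ, mul_comm]

lemma abs_corr_le {f g : E3 → ℝ} (hf : MemLp f 2 volume) (hg : MemLp g 2 volume) (y : E3) :
    |corr f g y| ≤ (eLpNorm f 2 volume).toReal * (eLpNorm g 2 volume).toReal := by
  have hfy := memLp_comp_add hf y
  have h : corr f g y = inner ℝ (hfy.toLp _) (hg.toLp g) := by
    rw [L2.inner_def, corr]
    refine integral_congr_ae ?_
    filter_upwards [hfy.coeFn_toLp, hg.coeFn_toLp] with x hx hx'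
    rw [hx, hx']
    simp [mul_comm]
  have h2 : eLpNorm (fun x => f (x + y)) 2 volume = eLpNorm f 2 volume :=
    eLpNorm_comp_measurePreserving hf.aestronglyMeasurable (measurePreserving_add_right volume y)
  rw [h]
  refine (abs_real_inner_le_norm _ _).trans (le_of_eq ?_)
  rw [Lp.norm_toLp, Lp.norm_toLp, h2]

lemma integrable_corr {f g : E3 → ℝ} (hf : MemLp f 2 volume) (hg : MemLp g 2 volume) (y : E3) :
    Integrable (fun x => f (x + y) * g x) volume :=
  (memLp_comp_add hf y).integrable_mul hg

/-- The correlation of compactly supported functions has compact support; approximation in `L²`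
changes `corr` uniformly little. -/
lemma tendsto_corr_cocompact {f g : E3 → ℝ} (hf : MemLp f 2 volume) (hg : MemLp g 2 volume) :
    Tendsto (corr f g) (cocompact E3) (𝓝 0) := by
  rw [Metric.tendsto_nhds]
  intro ε hε
  set A := (eLpNorm f 2 volume).toReal with hA
  set B := (eLpNorm g 2 volume).toReal with hB
  have hA0 : 0 ≤ A := ENNReal.toReal_nonneg
  have hB0 : 0 ≤ B := ENNReal.toReal_nonneg
  -- The two summands bound the errors from replacing `f`, then `g`, by an approximant; `A + δ`
  -- bounds the norm of the approximant of `f`.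
  obtain ⟨δ, hδ, hδ'⟩ : ∃ δ > 0, δ * B + (A + δ) * δ < ε := by
    refine ⟨min 1 (ε / (A + B + 2)), by positivity, ?_⟩
    have h1 : min 1 (ε / (A + B + 2)) ≤ 1 := min_le_left _ _
    have h2 : min 1 (ε / (A + B + 2)) ≤ ε / (A + B + 2) := min_le_right _ _
    have h3 : 0 < min 1 (ε / (A + B + 2)) := by positivity
    rw [le_div_iff₀ (by positivity)] at h2
    nlinarith
  have hδE : ENNReal.ofReal δ ≠ 0 := by simpa using hδ
  obtain ⟨f', hfs, hfd, -, hfm⟩ := hf.exists_hasCompactSupport_eLpNorm_sub_le (by simp) hδE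
  obtain ⟨g', hgs, hgd, -, hgm⟩ := hg.exists_hasCompactSupport_eLpNorm_sub_le (by simp) hδE
  have hfd' : (eLpNorm (f - f') 2 volume).toReal ≤ δ := ENNReal.toReal_le_of_le_ofReal hδ.le hfd
  have hgd' : (eLpNorm (g - g') 2 volume).toReal ≤ δ := ENNReal.toReal_le_of_le_ofReal hδ.le hgd
  have hf'n : (eLpNorm f' 2 volume).toReal ≤ A + δ := by
    have h1 : eLpNorm f' 2 volume ≤ eLpNorm f 2 volume + eLpNorm (f - f') 2 volume := by
      have := eLpNorm_sub_le hf.aestronglyMeasurable (hf.sub hfm).aestronglyMeasurable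
        (p := 2) (by norm_num)
      simpa using this
    have h2 := ENNReal.toReal_mono
      (ENNReal.add_ne_top.2 ⟨hf.eLpNorm_ne_top, (hf.sub hfm).eLpNorm_ne_top⟩) h1
    rw [ENNReal.toReal_add hf.eLpNorm_ne_top (hf.sub hfm).eLpNorm_ne_top] at h2
    linarith
  -- Outside the set of differences of the two supports, the shifted supports are disjoint.
  have hK : IsCompact ((fun p : E3 × E3 => p.1 - p.2) '' (tsupport f' ×ˢ tsupport g')) :=
    (hfs.isCompact.prod hgs.isCompact).image (by fun_prop)
  filter_upwards [hK.compl_mem_cocompact] with y hy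
  have h0 : corr f' g' y = 0 := by
    refine integral_eq_zero_of_ae (Eventually.of_forall fun x => ?_)
    by_contra hx
    rw [Pi.zero_apply, mul_eq_zero, not_or] at hx
    exact hy ⟨(x + y, x), ⟨subset_tsupport _ hx.1, subset_tsupport _ hx.2⟩, by simp⟩
  have hsplit : corr f g y = corr (f - f') g y + corr f' (g - g') y + corr f' g' y := by
    simp only [corr]
    have i1 := integrable_corr (hf.sub hfm) hg y
    have i2 := integrable_corr hfm (hg.sub hgm) y
    rw [← integral_add i1 i2, ← integral_add (by exact i1.add i2) (integrable_corr hfm hgm y)]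
    congr 1
    ext x
    simp only [Pi.sub_apply]
    ring
  have h1 := abs_corr_le (hf.sub hfm) hg y
  have h2 := abs_corr_le hfm (hg.sub hgm) y
  rw [Real.dist_eq, sub_zero, hsplit, h0, add_zero]
  have h3 := abs_add_le (corr (f - f') g y) (corr f' (g - g') y)
  have h4 : (eLpNorm (f - f') 2 volume).toReal * B ≤ δ * B := by gcongr
  have h5 : (eLpNorm f' 2 volume).toReal * (eLpNorm (g - g') 2 volume).toReal ≤ (A + δ) * δ := by
    gcongr
  linarith

/-- Young's inequality dominates the product by `(f(x+y)² + g(x)²) |φ(y)|`, and the shear `(x, y) ↦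
(x + y, y)` preserves measure. -/
lemma integrable_corr_prod {f g φ : E3 → ℝ} (hf : MemLp f 2 volume) (hg : MemLp g 2 volume)
    (hφ : Continuous φ) (hφc : HasCompactSupport φ) :
    Integrable (fun p : E3 × E3 => g p.1 * (f (p.1 + p.2) * φ p.2)) (volume.prod volume) := by
  have hφi : Integrable φ volume := hφ.integrable_of_hasCompactSupport hφc
  have hmp : MeasurePreserving (fun z : E3 × E3 => (z.1 + z.2, z.2))
      (volume.prod volume) (volume.prod volume) := measurePreserving_add_prod volume volume
  have hA : Integrable (fun p : E3 × E3 => f (p.1 + p.2) ^ 2 * ‖φ p.2‖) (volume.prod volume) :=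
    (hmp.integrable_comp (hf.integrable_sq.mul_prod hφi.norm).aestronglyMeasurable).2
      (hf.integrable_sq.mul_prod hφi.norm)
  have hB : Integrable (fun p : E3 × E3 => g p.1 ^ 2 * ‖φ p.2‖) (volume.prod volume) :=
    hg.integrable_sq.mul_prod hφi.norm
  have hm1 : AEStronglyMeasurable (fun p : E3 × E3 => f (p.1 + p.2)) (volume.prod volume) :=
    (hf.aestronglyMeasurable.comp_fst (ν := volume)).comp_measurePreserving hmp
  refine (hA.add hB).mono
    ((hg.aestronglyMeasurable.comp_fst).mul (hm1.mul hφi.aestronglyMeasurable.comp_snd)) ?_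
  refine Eventually.of_forall fun p => ?_
  simp only [Pi.add_apply, norm_mul, Real.norm_eq_abs]
  rw [abs_of_nonneg (a := f (p.1 + p.2) ^ 2 * |φ p.2| + g p.1 ^ 2 * |φ p.2|) (by positivity)]
  nlinarith [abs_nonneg (φ p.2), two_mul_le_add_sq |f (p.1 + p.2)| |g p.1|,
    sq_abs (f (p.1 + p.2)), sq_abs (g p.1), abs_nonneg (g p.1), abs_nonneg (f (p.1 + p.2)),
    mul_nonneg (abs_nonneg (φ p.2)) (add_nonneg (sq_nonneg |f (p.1 + p.2)|) (sq_nonneg |g p.1|)),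
    mul_le_mul_of_nonneg_left (two_mul_le_add_sq |f (p.1 + p.2)| |g p.1|) (abs_nonneg (φ p.2))]

/-- Fubini: a test function in the shift variable can be integrated against `f` alone. The primed
version below, obtained by the reflection `y ↦ -y`, integrates it against `g`. -/
lemma integral_corr_mul {f g φ : E3 → ℝ} (hf : MemLp f 2 volume) (hg : MemLp g 2 volume)
    (hφ : Continuous φ) (hφc : HasCompactSupport φ) :
    ∫ y, corr f g y * φ y = ∫ x, g x * ∫ y, f (x + y) * φ y := by
  have h := integral_integral_swap (f := fun x y => g x * (f (x + y) * φ y))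
    (integrable_corr_prod hf hg hφ hφc)
  simp only [integral_const_mul] at h
  rw [h]
  refine integral_congr_ae (Eventually.of_forall fun y => ?_)
  simp only [corr]
  rw [← integral_mul_const]
  congr 1
  ext x
  ring

lemma corr_eq_integral_sub (f g : E3 → ℝ) (y : E3) : corr f g y = ∫ x, f x * g (x - y) := by
  rw [corr, ← integral_add_right_eq_self (fun x => f x * g (x - y)) y]
  simp

lemma corr_neg (f g : E3 → ℝ) (y : E3) : corr f g y = corr g f (-y) := by
  rw [corr_eq_integral_sub, corr]
  congr 1
  ext x
  rw [mul_comm, sub_eq_add_neg]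

lemma integral_corr_mul' {f g φ : E3 → ℝ} (hf : MemLp f 2 volume) (hg : MemLp g 2 volume)
    (hφ : Continuous φ) (hφc : HasCompactSupport φ) :
    ∫ y, corr f g y * φ y = ∫ x, f x * ∫ y, g (x - y) * φ y := by
  have hφ' : Continuous fun y => φ (-y) := hφ.comp continuous_neg
  have hφc' : HasCompactSupport fun y => φ (-y) :=
    hφc.comp_homeomorph (Homeomorph.neg E3)
  rw [← integral_neg_eq_self]
  simp_rw [corr_neg f g, neg_neg]
  rw [integral_corr_mul hg hf hφ' hφc']
  congr 1
  ext x
  rw [← integral_neg_eq_self (fun y => g (x - y) * φ y)]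
  simp

/-! ### Partial derivatives of test functions and of translates -/

/-- The partial derivative `∂ᵢ φ`. -/
noncomputable def pd (i : Fin 3) (φ : E3 → ℝ) (x : E3) : ℝ :=
  fderiv ℝ φ x (EuclideanSpace.single i 1)

lemma contDiff_pd {φ : E3 → ℝ} (hφ : ContDiff ℝ ∞ φ) (i : Fin 3) : ContDiff ℝ ∞ (pd i φ) :=
  (hφ.fderiv_right (m := ∞) (by simp)).clm_apply contDiff_const

lemma hasCompactSupport_pd {φ : E3 → ℝ} (hφ : HasCompactSupport φ) (i : Fin 3) :
    HasCompactSupport (pd i φ) :=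
  (hφ.fderiv (𝕜 := ℝ)).comp_left (g := fun L : E3 →L[ℝ] ℝ => L (EuclideanSpace.single i 1)) (by simp)

lemma pd_comm {φ : E3 → ℝ} (hφ : ContDiff ℝ ∞ φ) (i j : Fin 3) :
    pd i (pd j φ) = pd j (pd i φ) := by
  ext x
  have hd : DifferentiableAt ℝ (fderiv ℝ φ) x :=
    (hφ.fderiv_right (m := ∞) (by simp)).differentiable (by simp) x
  have key : ∀ a b : E3, fderiv ℝ (fun z => fderiv ℝ φ z b) x a
      = fderiv ℝ (fderiv ℝ φ) x a b := fun a b => by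
    rw [fderiv_clm_apply hd (differentiableAt_const b)]
    simp
  change fderiv ℝ (fun z => fderiv ℝ φ z _) x _ = fderiv ℝ (fun z => fderiv ℝ φ z _) x _
  rw [key, key]
  exact (hφ.contDiffAt.isSymmSndFDerivAt
    (by simpa using WithTop.coe_le_coe.2 (le_top (a := (2 : ℕ∞))))) _ _

lemma pd_comp_sub_right (i : Fin 3) (φ : E3 → ℝ) (x : E3) :
    pd i (fun z => φ (z - x)) = fun z => pd i φ (z - x) := by
  ext z
  simp only [pd]
  rw [fderiv_comp_sub]

lemma pd_comp_sub_left (i : Fin 3) (φ : E3 → ℝ) (x : E3) :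
    pd i (fun z => φ (x - z)) = fun z => - pd i φ (x - z) := by
  ext z
  have h := pd_comp_sub_right i (fun w => φ (-w)) x
  have h2 : (fun z => φ (x - z)) = fun z => (fun w => φ (-w)) (z - x) := by
    ext w; simp
  rw [h2, h]
  simp only [pd]
  have h3 := fderiv_comp_smul (f := φ) (-1 : ℝ) (x := z - x)
  simp only [neg_smul, one_smul, neg_sub] at h3
  rw [h3]
  simp

lemma HasWeakPartial.integral_add_mul_pd {i : Fin 3} {f f' φ : E3 → ℝ} (h : HasWeakPartial i f f')
    (hφ : ContDiff ℝ ∞ φ) (hφc : HasCompactSupport φ) (x : E3) :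
    ∫ y, f (x + y) * pd i φ y = - ∫ y, f' (x + y) * φ y := by
  have := h.2.2 (fun z => φ (z - x)) (hφ.comp (contDiff_id.sub contDiff_const))
    (hφc.comp_homeomorph (Homeomorph.subRight x))
  change ∫ z, f z * pd i (fun z => φ (z - x)) z = _ at this
  rw [pd_comp_sub_right, ← integral_add_left_eq_self _ x,
    ← integral_add_left_eq_self (fun z => f' z * φ (z - x)) x] at this
  simpa using this

/-- The test function is `z ↦ φ (x - z)`; the chain rule sign of the reflection cancels the minus
sign of the weak derivative. -/
lemma HasWeakPartial.integral_sub_mul_pd {i : Fin 3} {f f' φ : E3 → ℝ} (h : HasWeakPartial i f f')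
    (hφ : ContDiff ℝ ∞ φ) (hφc : HasCompactSupport φ) (x : E3) :
    ∫ y, f (x - y) * pd i φ y = ∫ y, f' (x - y) * φ y := by
  have := h.2.2 (fun z => φ (x - z)) (hφ.comp (contDiff_const.sub contDiff_id))
    (hφc.comp_homeomorph (Homeomorph.subLeft x))
  change ∫ z, f z * pd i (fun z => φ (x - z)) z = _ at this
  rw [pd_comp_sub_left, ← integral_sub_left_eq_self _ volume x,
    ← integral_sub_left_eq_self (fun z => f' z * φ (x - z)) volume x] at this
  simpa [integral_neg] using this

/-! ### Integration by parts and orthogonality of gradients -/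

/-- Integration by parts on `ℝ³` for square integrable weak derivatives. -/
theorem HasWeakPartial.integral_mul_eq_neg {i : Fin 3} {f f' g g' : E3 → ℝ}
    (hf : HasWeakPartial i f f') (hg : HasWeakPartial i g g')
    (hf2 : MemLp f 2 volume) (hf2' : MemLp f' 2 volume)
    (hg2 : MemLp g 2 volume) (hg2' : MemLp g' 2 volume) :
    ∫ x, f' x * g x = - ∫ x, f x * g' x := by
  have hc1 := continuous_corr hf2' hg2
  have hc2 := continuous_corr hf2 hg2'
  -- Both sides are the weak derivative of `corr f g`, with the derivative moved onto one factor or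
  -- the other.
  have hae : ∀ᵐ y ∂(volume : Measure E3), corr f' g y = - corr f g' y := by
    refine ae_eq_of_integral_contDiff_smul_eq hc1.locallyIntegrable
      (hc2.neg.locallyIntegrable) fun φ hφ hφc => ?_
    have e1 := integral_corr_mul hf2 hg2 (contDiff_pd hφ i).continuous (hasCompactSupport_pd hφc i)
    have e2 := integral_corr_mul' hf2 hg2 (contDiff_pd hφ i).continuous
      (hasCompactSupport_pd hφc i)
    simp_rw [hf.integral_add_mul_pd hφ hφc] at e1
    simp_rw [hg.integral_sub_mul_pd hφ hφc] at e2
    simp_rw [mul_neg, integral_neg] at e1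
    rw [← integral_corr_mul hf2' hg2 hφ.continuous hφc] at e1
    rw [← integral_corr_mul' hf2 hg2' hφ.continuous hφc] at e2
    simp_rw [smul_eq_mul, mul_neg, integral_neg]
    simp_rw [mul_comm (φ _)]
    linarith
  -- Continuity upgrades almost everywhere equality to every shift, in particular `y = 0`.
  have h := congrFun (hc1.ae_eq_iff_eq volume hc2.neg |>.1 hae) 0
  simpa [corr] using h

-- Mollification turns a vanishing weak derivative into a vanishing classical one: `S ⋆ φ` is
-- constant on the line spanned by `e`, and tends to zero along it because `S` does at infinity.
open scoped Convolution in
lemma eq_zero_of_integral_mul_pd_eq_zero {S : E3 → ℝ} {C : ℝ} (i : Fin 3) (hS : Continuous S)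
    (hb : ∀ y, |S y| ≤ C) (h0 : Tendsto S (cocompact E3) (𝓝 0))
    (h : ∀ φ : E3 → ℝ, ContDiff ℝ ∞ φ → HasCompactSupport φ → ∫ y, S y * pd i φ y = 0) :
    S = 0 := by
  set e : E3 := EuclideanSpace.single i 1 with he
  have key : ∀ φ : E3 → ℝ, ContDiff ℝ ∞ φ → HasCompactSupport φ → ∫ t, S t * φ (0 - t) = 0 := by
    intro φ hφ hφc
    have hder : ∀ s : ℝ, HasDerivAt
        (fun s : ℝ => (S ⋆[ContinuousLinearMap.mul ℝ ℝ, volume] φ) (s • e)) 0 s := by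
      intro s
      have h1 := hφc.hasFDerivAt_convolution_right (ContinuousLinearMap.mul ℝ ℝ) (μ := volume)
        hS.locallyIntegrable (hφ.of_le (by exact_mod_cast le_top)) (s • e)
      have h2 : HasDerivAt (fun s : ℝ => s • e) e s := by
        simpa using (hasDerivAt_id s).smul_const e
      have h3 := h1.comp_hasDerivAt s h2
      rw [convolution_precompR_apply _ hS.locallyIntegrable (hφc.fderiv (𝕜 := ℝ))
        (hφ.continuous_fderiv (by simp))] at h3
      refine h3.congr_deriv ?_
      change ∫ t, S t * pd i φ (s • e - t) = 0
      have h4 := h (fun t => φ (s • e - t)) (hφ.comp (contDiff_const.sub contDiff_id))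
        (hφc.comp_homeomorph (Homeomorph.subLeft (s • e)))
      rw [pd_comp_sub_left] at h4
      simp only [mul_neg, integral_neg, neg_eq_zero] at h4
      exact h4
    have hconst : ∀ s : ℝ, (S ⋆[ContinuousLinearMap.mul ℝ ℝ, volume] φ) (s • e)
        = ∫ t, S t * φ (0 - t) := fun s => by
      have := is_const_of_deriv_eq_zero (fun s => (hder s).differentiableAt)
        (fun s => (hder s).deriv) s 0
      simpa [convolution] using this
    have hlim : Tendsto (fun s : ℝ => (S ⋆[ContinuousLinearMap.mul ℝ ℝ, volume] φ) (s • e))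
        atTop (𝓝 0) := by
      have hrw : ∀ s : ℝ, (S ⋆[ContinuousLinearMap.mul ℝ ℝ, volume] φ) (s • e)
          = ∫ t, S (s • e - t) * φ t := fun s => by
        rw [← integral_sub_left_eq_self _ volume (s • e)]
        simp [convolution]
      simp_rw [hrw]
      rw [show (0 : ℝ) = ∫ t : E3, (0 : ℝ) by simp]
      refine tendsto_integral_filter_of_dominated_convergence (fun t => C * |φ t|)
        (Eventually.of_forall fun s => ?_) (Eventually.of_forall fun s => ?_) ?_ ?_
      · exact ((hS.comp (by fun_prop)).mul hφ.continuous).aestronglyMeasurable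
      · refine Eventually.of_forall fun t => ?_
        rw [norm_mul, Real.norm_eq_abs, Real.norm_eq_abs]
        exact mul_le_mul_of_nonneg_right (hb _) (abs_nonneg _)
      · exact (hφ.continuous.integrable_of_hasCompactSupport hφc).norm.const_mul C
      · refine Eventually.of_forall fun t => ?_
        have hco : Tendsto (fun s : ℝ => s • e - t) atTop (cocompact E3) := by
          rw [← Metric.cobounded_eq_cocompact, ← comap_norm_atTop, tendsto_comap_iff]
          have hle : ∀ s : ℝ, s - ‖t‖ ≤ ‖s • e - t‖ := fun s => by
            have := norm_sub_norm_le (s • e) t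
            have h1 : ‖s • e‖ = |s| := by simp [he, norm_smul]
            linarith [le_abs_self s]
          exact tendsto_atTop_mono hle (tendsto_atTop_add_const_right _ _ tendsto_id)
        simpa using (h0.comp hco).mul_const (φ t)
    simp_rw [hconst] at hlim
    exact tendsto_nhds_unique tendsto_const_nhds hlim
  have hae : ∀ᵐ y ∂(volume : Measure E3), S y = (0 : E3 → ℝ) y := by
    refine ae_eq_zero_of_integral_contDiff_smul_eq_zero hS.locallyIntegrable fun φ hφ hφc => ?_
    have := key (fun t => φ (-t)) (hφ.comp contDiff_neg) (hφc.comp_homeomorph (Homeomorph.neg E3))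
    simpa [mul_comm] using this
  exact hS.ae_eq_iff_eq volume continuous_const |>.1 hae

/-- A square integrable weak gradient is orthogonal to square integrable divergence-free fields. -/
theorem sum_integral_gradient_mul_eq_zero {q : E3 → ℝ} {G v d : Fin 3 → E3 → ℝ}
    (hG : ∀ k, HasWeakPartial k q (G k)) (hG2 : ∀ k, MemLp (G k) 2 volume)
    (hv : ∀ k, HasWeakPartial k (v k) (d k)) (hv2 : ∀ k, MemLp (v k) 2 volume)
    (hd2 : ∀ k, MemLp (d k) 2 volume) (hdiv : ∀ᵐ x, ∑ k, d k x = 0) :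
    ∑ k, ∫ x, G k x * v k x = 0 := by
  set S : E3 → ℝ := fun y => ∑ k, corr (G k) (v k) y with hS
  have hc : ∀ j k, Continuous (corr (G j) (v k)) := fun j k => continuous_corr (hG2 j) (hv2 k)
  have hSc : Continuous S := continuous_finsetSum _ fun k _ => hc k k
  have hS0 : Tendsto S (cocompact E3) (𝓝 0) := by
    have := tendsto_finsetSum Finset.univ
      fun (k : Fin 3) _ => tendsto_corr_cocompact (hG2 k) (hv2 k)
    simpa using this
  have hb : ∀ y, |S y| ≤ ∑ k, (eLpNorm (G k) 2 volume).toReal * (eLpNorm (v k) 2 volume).toReal :=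
    fun y => (Finset.abs_sum_le_sum_abs _ _).trans
      (Finset.sum_le_sum fun k _ => abs_corr_le (hG2 k) (hv2 k) y)
  have hz : S = 0 := by
    -- The direction `0` is arbitrary; one direction suffices.
    refine eq_zero_of_integral_mul_pd_eq_zero 0 hSc hb hS0 fun φ hφ hφc => ?_
    have hint : ∀ {c ψ : E3 → ℝ}, Continuous c → Continuous ψ → HasCompactSupport ψ →
        Integrable (fun y => c y * ψ y) volume := fun hc hψ hψc =>
      (hc.mul hψ).integrable_of_hasCompactSupport hψc.mul_left
    -- The gradient is curl free: `∂₀Gₖ = ∂ₖG₀`, by commuting the derivatives of the test function.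
    have hcross : ∀ k, ∫ y, corr (G k) (v k) y * pd 0 φ y = ∫ y, corr (G 0) (v k) y * pd k φ y := by
      intro k
      rw [integral_corr_mul (hG2 k) (hv2 k) (contDiff_pd hφ 0).continuous
          (hasCompactSupport_pd hφc 0),
        integral_corr_mul (hG2 0) (hv2 k) (contDiff_pd hφ k).continuous
          (hasCompactSupport_pd hφc k)]
      congr 1
      ext x
      congr 1
      have e1 := (hG k).integral_add_mul_pd (contDiff_pd hφ 0) (hasCompactSupport_pd hφc 0) x
      have e2 := (hG 0).integral_add_mul_pd (contDiff_pd hφ k) (hasCompactSupport_pd hφc k) x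
      rw [pd_comm hφ] at e1
      linarith
    -- The derivative `∂ₖ` now falls on `vₖ`, so that summing over `k` produces the divergence.
    have hdk : ∀ k, ∫ y, corr (G 0) (v k) y * pd k φ y = ∫ y, corr (G 0) (d k) y * φ y := by
      intro k
      rw [integral_corr_mul' (hG2 0) (hv2 k) (contDiff_pd hφ k).continuous
          (hasCompactSupport_pd hφc k), integral_corr_mul' (hG2 0) (hd2 k) hφ.continuous hφc]
      simp_rw [(hv k).integral_sub_mul_pd hφ hφc]
    simp only [hS, Finset.sum_mul]
    rw [integral_finsetSum _ fun k _ => hint (hc k k) (contDiff_pd hφ 0).continuous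
      (hasCompactSupport_pd hφc 0)]
    simp_rw [hcross, hdk]
    rw [← integral_finsetSum _ fun k _ => hint (continuous_corr (hG2 0) (hd2 k))
      hφ.continuous hφc]
    refine integral_eq_zero_of_ae (Eventually.of_forall fun y => ?_)
    simp only [← Finset.sum_mul, corr]
    rw [← integral_finsetSum _ fun k _ => integrable_corr (hG2 0) (hd2 k) y]
    have : ∫ x, ∑ k, G 0 (x + y) * d k x = 0 := by
      refine integral_eq_zero_of_ae ?_
      filter_upwards [hdiv] with x hx
      simp [← Finset.mul_sum, hx]
    simp [this]
  have := congrFun hz 0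
  simpa [hS, corr] using this

/-! ### Weak derivatives and primitives in one variable -/

section Calculus

lemma deriv_smoothTransition_eq_zero {s : ℝ} (hs : s ∉ Icc (0 : ℝ) 1) :
    deriv Real.smoothTransition s = 0 := by
  rw [mem_Icc, not_and_or, not_le, not_le] at hs
  rcases hs with hs | hs
  · have : Real.smoothTransition =ᶠ[𝓝 s] fun _ => 0 := by
      filter_upwards [gt_mem_nhds hs] with t ht
      exact Real.smoothTransition.zero_of_nonpos (le_of_lt ht)
    rw [this.deriv_eq, deriv_const]
  · have : Real.smoothTransition =ᶠ[𝓝 s] fun _ => 1 := by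
      filter_upwards [lt_mem_nhds hs] with t ht
      exact Real.smoothTransition.one_of_one_le (le_of_lt ht)
    rw [this.deriv_eq, deriv_const]

lemma continuous_deriv_smoothTransition : Continuous (deriv Real.smoothTransition) :=
  (Real.smoothTransition.contDiff (n := 1)).continuous_deriv (by simp)

lemma integrable_deriv_smoothTransition : Integrable (deriv Real.smoothTransition) volume :=
  continuous_deriv_smoothTransition.integrable_of_hasCompactSupport
    (HasCompactSupport.intro isCompact_Icc fun _ hs => deriv_smoothTransition_eq_zero hs)

lemma integral_deriv_smoothTransition : ∫ s, deriv Real.smoothTransition s = 1 := by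
  rw [← setIntegral_eq_integral_of_forall_compl_eq_zero (s := Icc (0 : ℝ) 1)
    fun s hs => deriv_smoothTransition_eq_zero hs, integral_Icc_eq_integral_Ioc,
    ← intervalIntegral.integral_of_le zero_le_one,
    intervalIntegral.integral_deriv_eq_sub
      (fun x _ => (Real.smoothTransition.contDiff (n := 1)).differentiable (by simp) x)
      (continuous_deriv_smoothTransition.intervalIntegrable _ _)]
  simp

/-- A smooth approximation of the indicator function of `(a, ∞)`. -/
noncomputable def smoothStep (a ε t : ℝ) : ℝ := Real.smoothTransition (ε⁻¹ * (t - a))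

lemma contDiff_smoothStep (a ε : ℝ) : ContDiff ℝ ∞ (smoothStep a ε) :=
  (Real.smoothTransition.contDiff (n := ⊤)).comp
    (contDiff_const.mul (contDiff_id.sub contDiff_const))

lemma deriv_smoothStep (a ε t : ℝ) :
    deriv (smoothStep a ε) t = ε⁻¹ * deriv Real.smoothTransition (ε⁻¹ * (t - a)) := by
  have h1 : HasDerivAt (fun t => ε⁻¹ * (t - a)) ε⁻¹ t := by
    simpa using ((hasDerivAt_id t).sub_const a).const_mul ε⁻¹
  have h2 := ((Real.smoothTransition.contDiff (n := 1)).differentiable (by simp)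
    (ε⁻¹ * (t - a))).hasDerivAt.comp t h1
  rw [mul_comm]
  exact h2.deriv

lemma smoothStep_eq_zero {a ε t : ℝ} (hε : 0 < ε) (h : t ≤ a) : smoothStep a ε t = 0 :=
  Real.smoothTransition.zero_of_nonpos
    (mul_nonpos_of_nonneg_of_nonpos (inv_pos.2 hε).le (by linarith))

lemma smoothStep_eq_one {a ε t : ℝ} (hε : 0 < ε) (h : a + ε ≤ t) : smoothStep a ε t = 1 := by
  refine Real.smoothTransition.one_of_one_le ?_
  rw [inv_mul_eq_div, le_div_iff₀ hε]
  linarith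

lemma abs_smoothStep_le (a ε t : ℝ) : |smoothStep a ε t| ≤ 1 :=
  (abs_of_nonneg (Real.smoothTransition.nonneg _)).trans_le (Real.smoothTransition.le_one _)

lemma tendsto_smoothStep (a t : ℝ) :
    Tendsto (fun ε => smoothStep a ε t) (𝓝[>] 0) (𝓝 ((Ioi a).indicator 1 t)) := by
  by_cases h : a < t
  · rw [indicator_of_mem (mem_Ioi.2 h)]
    refine tendsto_const_nhds.congr' ?_
    filter_upwards [Ioo_mem_nhdsGT (sub_pos.2 h)] with ε hε
    rw [smoothStep_eq_one hε.1 (by linarith [hε.2])]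
    rfl
  · rw [indicator_of_notMem (by simpa using h)]
    refine tendsto_const_nhds.congr' ?_
    filter_upwards [self_mem_nhdsWithin] with ε hε
    rw [smoothStep_eq_zero hε (not_lt.1 h)]

lemma tendsto_integral_mul_deriv_smoothStep {m : ℝ → ℝ} {C : ℝ} (hm : Continuous m)
    (hb : ∀ t, |m t| ≤ C) (a : ℝ) :
    Tendsto (fun ε => ∫ t, m t * deriv (smoothStep a ε) t) (𝓝[>] 0) (𝓝 (m a)) := by
  -- The substitution `t = a + ε s` turns the derivative of the step into a fixed kernel of mass
  -- one.
  have hsub : ∀ᶠ ε in 𝓝[>] (0 : ℝ), ∫ s, m (a + ε * s) * deriv Real.smoothTransition s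
      = ∫ t, m t * deriv (smoothStep a ε) t := by
    filter_upwards [self_mem_nhdsWithin] with ε hε
    have hε : 0 < ε := hε
    rw [← integral_add_left_eq_self (fun t => m t * deriv (smoothStep a ε) t) a]
    have := Measure.integral_comp_mul_left
      (fun t => m (a + t) * deriv (smoothStep a ε) (a + t)) ε
    simp only [deriv_smoothStep, add_sub_cancel_left, inv_mul_cancel_left₀ hε.ne'] at this ⊢
    rw [abs_of_pos (inv_pos.2 hε), smul_eq_mul, eq_inv_mul_iff_mul_eq₀ hε.ne',
      ← integral_const_mul] at this
    rw [← this]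
    congr 1
    ext s
    field_simp
  refine Tendsto.congr' hsub ?_
  have h1 : m a = ∫ s, m (a + 0 * s) * deriv Real.smoothTransition s := by
    simp [integral_const_mul, integral_deriv_smoothTransition]
  rw [h1]
  refine tendsto_integral_filter_of_dominated_convergence
    (fun s => C * |deriv Real.smoothTransition s|) (Eventually.of_forall fun ε => ?_)
    (Eventually.of_forall fun ε => ?_) (integrable_deriv_smoothTransition.norm.const_mul C) ?_
  · exact ((hm.comp (by fun_prop)).mul continuous_deriv_smoothTransition).aestronglyMeasurable
  · refine Eventually.of_forall fun s => ?_
    rw [norm_mul, Real.norm_eq_abs, Real.norm_eq_abs]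
    exact mul_le_mul_of_nonneg_right (hb _) (abs_nonneg _)
  · refine Eventually.of_forall fun s => ?_
    have : Continuous fun ε => m (a + ε * s) * deriv Real.smoothTransition s :=
      (hm.comp (by fun_prop)).mul continuous_const
    exact (this.tendsto 0).mono_left nhdsWithin_le_nhds

/-- A continuous function on `[0,T]` with integrable weak derivative `n` is a primitive of `n`. -/
lemma sub_eq_integral_of_weak_deriv {m n : ℝ → ℝ} {T : ℝ} (hT : 0 < T)
    (hm : ContinuousOn m (Icc 0 T)) (hn : IntegrableOn n (Ioo 0 T))
    (h : ∀ η : ℝ → ℝ, ContDiff ℝ ∞ η → HasCompactSupport η → tsupport η ⊆ Ioo 0 T →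
      ∫ t in Ioo 0 T, m t * deriv η t = - ∫ t in Ioo 0 T, n t * η t) :
    ∀ t ∈ Icc 0 T, m t - m 0 = ∫ s in (0 : ℝ)..t, n s := by
  -- The constant extension makes `m` continuous and bounded on the whole line.
  set M : ℝ → ℝ := IccExtend hT.le ((Icc 0 T).domRestrict m) with hM
  have hMm : ∀ t ∈ Icc 0 T, M t = m t := fun t ht => IccExtend_of_mem _ _ ht
  have hMc : Continuous M := (continuousOn_iff_continuous_domRestrict.1 hm).Icc_extend'
  obtain ⟨C, hC⟩ : ∃ C, ∀ t, |M t| ≤ C := by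
    obtain ⟨C, hC⟩ := isCompact_Icc.exists_bound_of_continuousOn hm
    exact ⟨C, fun t => hC _ (projIcc 0 T hT.le t).2⟩
  have hnT : IntervalIntegrable n volume 0 T := by
    rw [intervalIntegrable_iff_integrableOn_Ioo_of_le hT.le]
    exact hn
  set N : ℝ → ℝ := fun a => ∫ t in Ioo 0 T, n t * (Ioi a).indicator 1 t with hN
  have hNT : ∀ a ∈ Ioo 0 T, N a = ∫ t in a..T, n t := fun a ha => by
    have : ∀ t, n t * (Ioi a).indicator 1 t = (Ioi a).indicator n t := fun t => by
      by_cases h : t ∈ Ioi a <;> simp [h]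
    simp only [hN, this]
    rw [setIntegral_indicator measurableSet_Ioi, intervalIntegral.integral_of_le ha.2.le,
      integral_Ioc_eq_integral_Ioo]
    congr 2
    ext t
    simp only [mem_inter_iff, mem_Ioo, mem_Ioi]
    constructor
    · rintro ⟨h1, h2⟩
      exact ⟨h2, h1.2⟩
    · rintro ⟨h1, h2⟩
      exact ⟨⟨ha.1.trans h1, h2⟩, h1⟩
  -- The difference of smooth steps at `a` and `b` is an admissible test function; as `ε → 0` its
  -- derivative tends to the difference of point masses at `a` and `b`.
  have hstep : ∀ a b, a ∈ Ioo 0 T → b ∈ Ioo 0 T → m a + N a = m b + N b := by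
    intro a b ha hb
    have hlimN : ∀ a, Tendsto (fun ε => ∫ t in Ioo 0 T, n t * smoothStep a ε t) (𝓝[>] 0)
        (𝓝 (N a)) := by
      intro a
      refine tendsto_integral_filter_of_dominated_convergence (fun t => |n t|)
        (Eventually.of_forall fun ε => ?_) (Eventually.of_forall fun ε => ?_) hn.norm ?_
      · exact hn.aestronglyMeasurable.mul (contDiff_smoothStep a ε).continuous.aestronglyMeasurable
      · refine Eventually.of_forall fun t => ?_
        rw [norm_mul, Real.norm_eq_abs, Real.norm_eq_abs]
        exact mul_le_of_le_one_right (abs_nonneg _) (abs_smoothStep_le _ _ _)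
      · exact Eventually.of_forall fun t => (tendsto_smoothStep a t).const_mul (n t)
    have hl1 := (tendsto_integral_mul_deriv_smoothStep hMc hC a).sub
      (tendsto_integral_mul_deriv_smoothStep hMc hC b)
    have hl2 := ((hlimN a).sub (hlimN b)).neg
    have heq : ∀ᶠ ε in 𝓝[>] (0 : ℝ),
        (∫ t, M t * deriv (smoothStep a ε) t) - ∫ t, M t * deriv (smoothStep b ε) t
        = -((∫ t in Ioo 0 T, n t * smoothStep a ε t) - ∫ t in Ioo 0 T, n t * smoothStep b ε t) := by
      have hpos : 0 < T - max a b := sub_pos.2 (max_lt ha.2 hb.2)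
      filter_upwards [Ioo_mem_nhdsGT hpos] with ε hε
      have hz : ∀ t, t ∉ Icc (min a b) (max a b + ε) → smoothStep a ε t - smoothStep b ε t = 0 := by
        intro t ht
        rw [mem_Icc, not_and_or, not_le, not_le] at ht
        rcases ht with ht | ht
        · rw [smoothStep_eq_zero hε.1 (ht.le.trans (min_le_left _ _)),
            smoothStep_eq_zero hε.1 (ht.le.trans (min_le_right _ _)), sub_zero]
        · rw [smoothStep_eq_one hε.1 (by linarith [le_max_left a b]),
            smoothStep_eq_one hε.1 (by linarith [le_max_right a b]), sub_self]
      have hsub : tsupport (fun t => smoothStep a ε t - smoothStep b ε t)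
          ⊆ Icc (min a b) (max a b + ε) :=
        closure_minimal (fun t ht => by_contra fun h' => ht (hz t h')) isClosed_Icc
      have hsub2 : Icc (min a b) (max a b + ε) ⊆ Ioo 0 T :=
        Icc_subset_Ioo (lt_min ha.1 hb.1) (by linarith [hε.2])
      have hd : ∀ t, deriv (fun t => smoothStep a ε t - smoothStep b ε t) t
          = deriv (smoothStep a ε) t - deriv (smoothStep b ε) t := fun t =>
        deriv_fun_sub ((contDiff_smoothStep a ε).differentiable (by simp) t)
          ((contDiff_smoothStep b ε).differentiable (by simp) t)
      have hkey := h _ ((contDiff_smoothStep a ε).sub (contDiff_smoothStep b ε))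
        (HasCompactSupport.intro isCompact_Icc hz) (hsub.trans hsub2)
      have hint : ∀ c, Integrable (fun t => M t * deriv (smoothStep c ε) t) volume := fun c => by
        refine Continuous.integrable_of_hasCompactSupport
          (hMc.mul ((contDiff_smoothStep c ε).continuous_deriv (by simp)))
          (HasCompactSupport.intro (K := Icc c (c + ε)) isCompact_Icc fun t ht => ?_)
        rw [deriv_smoothStep, deriv_smoothTransition_eq_zero, mul_zero, mul_zero]
        contrapose! ht
        rw [inv_mul_eq_div] at ht
        have h1 := ht.1
        have h2 := ht.2
        rw [le_div_iff₀ hε.1] at h1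
        rw [div_le_iff₀ hε.1] at h2
        constructor <;> linarith
      have hintn : ∀ c, IntegrableOn (fun t => n t * smoothStep c ε t) (Ioo 0 T) volume := fun c =>
        hn.mul_bdd (c := 1) (contDiff_smoothStep c ε).continuous.aestronglyMeasurable
          (Eventually.of_forall fun t => abs_smoothStep_le c ε t)
      rw [← integral_sub (hint a) (hint b), ← integral_sub (hintn a) (hintn b)]
      simp only [← mul_sub]
      rw [← hkey, ← setIntegral_eq_integral_of_forall_compl_eq_zero (s := Ioo 0 T)]
      · refine setIntegral_congr_fun measurableSet_Ioo fun t ht => ?_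
        simp only [hd, hMm t (Ioo_subset_Icc_self ht)]
      · intro t ht
        rw [← hd, Function.notMem_support.1 (fun h' => ht
          ((hsub.trans hsub2) (support_deriv_subset h'))), mul_zero]
    have := tendsto_nhds_unique (hl1.congr' heq) hl2
    rw [hMm a (Ioo_subset_Icc_self ha), hMm b (Ioo_subset_Icc_self hb)] at this
    linarith
  have hnc : ContinuousOn (fun a => ∫ t in a..T, n t) (Icc 0 T) := by
    have := intervalIntegral.continuousOn_primitive_interval_left (a := 0) (b := T) (f := n)
      (μ := volume) (by rw [uIcc_of_le hT.le, integrableOn_Icc_iff_integrableOn_Ioo]; exact hn)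
    rwa [uIcc_of_le hT.le] at this
  have hmid : T / 2 ∈ Ioo 0 T := ⟨by linarith, by linarith⟩
  -- Continuity carries the identity to the endpoints, in particular to time `0`.
  have hall : EqOn (fun a => m a + ∫ t in a..T, n t) (fun _ => m (T / 2) + N (T / 2)) (Icc 0 T) := by
    refine EqOn.of_subset_closure (s := Ioo 0 T) (fun a ha => ?_) (hm.add hnc) continuousOn_const
      Ioo_subset_Icc_self (by rw [closure_Ioo hT.ne])
    rw [← hNT a ha]
    exact hstep _ _ ha hmid
  intro t ht
  have h1 := hall ht
  have h2 := hall (left_mem_Icc.2 hT.le)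
  have hi : IntervalIntegrable n volume 0 t :=
    hnT.mono_set (by rw [uIcc_of_le hT.le, uIcc_of_le ht.1]; exact Icc_subset_Icc_right ht.2)
  have hi' : IntervalIntegrable n volume t T :=
    hnT.mono_set (by rw [uIcc_of_le hT.le, uIcc_of_le ht.2]; exact Icc_subset_Icc_left ht.1)
  have h3 := intervalIntegral.integral_add_adjacent_intervals hi hi'
  simp only at h1 h2
  linarith

/-- `F(t)² = 2 ∫₀ᵗ F n` for the primitive `F` of an integrable function `n`. -/
lemma sq_integral_eq {n : ℝ → ℝ} {t : ℝ} (hn : IntervalIntegrable n volume 0 t) :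
    (∫ s in (0 : ℝ)..t, n s) ^ 2 = 2 * ∫ s in (0 : ℝ)..t, (∫ r in (0 : ℝ)..s, n r) * n s := by
  -- The primitive is absolutely continuous, so the product rule integrates for its square.
  have hac := hn.absolutelyContinuousOnInterval_intervalIntegral (c := 0) (by simp)
  have h := hac.integral_deriv_mul_eq_sub hac
  simp only [intervalIntegral.integral_same, mul_zero, sub_zero] at h
  rw [pow_two, ← h, ← intervalIntegral.integral_const_mul]
  refine intervalIntegral.integral_congr_ae ?_
  filter_upwards [hn.ae_hasDerivAt_integral] with s hs hs'
  rw [(hs (uIoc_subset_uIcc hs') 0 (by simp)).deriv]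
  ring

end Calculus

/-! ### Null sets and slices in product spaces -/

section Product

variable {α β : Type*} [MeasurableSpace α] [MeasurableSpace β] {μ : Measure α} {ν : Measure β}
  [SFinite ν]

lemma ae_eq_prod_of_ae_ae {f g : α × β → ℝ} (hf : AEStronglyMeasurable f (μ.prod ν))
    (hg : AEStronglyMeasurable g (μ.prod ν)) (h : ∀ᵐ x ∂μ, ∀ᵐ y ∂ν, f (x, y) = g (x, y)) :
    f =ᵐ[μ.prod ν] g := by
  have hm : MeasurableSet {p | hf.mk f p = hg.mk g p} :=
    measurableSet_eq_fun hf.stronglyMeasurable_mk.measurable hg.stronglyMeasurable_mk.measurable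
  have hmk : hf.mk f =ᵐ[μ.prod ν] hg.mk g := by
    refine (Measure.ae_prod_iff_ae_ae hm).2 ?_
    filter_upwards [h, Measure.ae_ae_of_ae_prod hf.ae_eq_mk, Measure.ae_ae_of_ae_prod hg.ae_eq_mk]
      with x h1 h2 h3
    filter_upwards [h1, h2, h3] with y h1 h2 h3
    rw [← h2, h1, h3]
  exact hf.ae_eq_mk.trans (hmk.trans hg.ae_eq_mk.symm)

lemma ae_ae_swap_of_ae_prod [SFinite μ] {P : α × β → Prop} (h : ∀ᵐ p ∂μ.prod ν, P p) :
    ∀ᵐ y ∂ν, ∀ᵐ x ∂μ, P (x, y) := by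
  have : ∀ᵐ p ∂ν.prod μ, P p.swap :=
    (Measure.measurePreserving_swap (μ := ν) (ν := μ)).quasiMeasurePreserving.ae h
  exact Measure.ae_ae_of_ae_prod this

lemma memLp_two_ae_left [SFinite μ] {f : α × β → ℝ}
    (hf : MemLp f 2 (μ.prod ν)) :
    ∀ᵐ x ∂μ, MemLp (fun y => f (x, y)) 2 ν := by
  filter_upwards [hf.aestronglyMeasurable.prodMk_left, hf.integrable_sq.prod_right_ae] with x h1 h2
  exact (memLp_two_iff_integrable_sq h1).2 h2

lemma memLp_two_ae_right [SFinite μ] {f : α × β → ℝ} (hf : MemLp f 2 (μ.prod ν)) :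
    ∀ᵐ y ∂ν, MemLp (fun x => f (x, y)) 2 μ := by
  filter_upwards [hf.aestronglyMeasurable.prodMk_right, hf.integrable_sq.prod_left_ae] with x h1 h2
  exact (memLp_two_iff_integrable_sq h1).2 h2

end Product

/-! ### Time integration and the energy identity -/

lemma slabMeasure_eq_restrict (T : ℝ) :
    slabMeasure T = (volume : Measure (ℝ × E3)).restrict (Ioo 0 T ×ˢ univ) := by
  rw [slabMeasure, Measure.volume_eq_prod, ← Measure.prod_restrict, Measure.restrict_univ]

lemma slabMeasure_mono {s t : ℝ} (h : s ≤ t) : slabMeasure s ≤ slabMeasure t := by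
  rw [slabMeasure_eq_restrict, slabMeasure_eq_restrict]
  exact Measure.restrict_mono (prod_mono (Ioo_subset_Ioo_right h) le_rfl) le_rfl

lemma continuousOn_integral_mul {f : ℝ → E3 → ℝ} {φ : E3 → ℝ} {T : ℝ} (hf : MemC0L2 T f)
    (hφ : MemLp φ 2 volume) : ContinuousOn (fun t => ∫ x, f t x * φ x) (Icc 0 T) := by
  intro t ht
  have hlim := hf.2.2 t ht
  have h1 : Tendsto (fun s => (eLpNorm (f s - f t) 2 volume).toReal * (eLpNorm φ 2 volume).toReal)
      (𝓝[Icc 0 T] t) (𝓝 0) := by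
    have := ((ENNReal.tendsto_toReal ENNReal.zero_ne_top).comp hlim).mul_const
      (eLpNorm φ 2 volume).toReal
    simpa using this
  change Tendsto _ _ _
  rw [tendsto_iff_norm_sub_tendsto_zero]
  refine squeeze_zero' (Eventually.of_forall fun _ => norm_nonneg _) ?_ h1
  filter_upwards [self_mem_nhdsWithin] with s hs
  have hs2 := (hf.2.1 s hs)
  have ht2 := (hf.2.1 t ht)
  have := abs_corr_le (hs2.sub ht2) hφ 0
  have is : Integrable (fun x => f s x * φ x) volume := hs2.integrable_mul hφ
  have it : Integrable (fun x => f t x * φ x) volume := ht2.integrable_mul hφ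
  rw [← integral_sub is it]
  simp only [corr, add_zero] at this
  refine le_trans (le_of_eq ?_) this
  rw [Real.norm_eq_abs]
  congr 2
  ext x
  simp only [Pi.sub_apply]
  ring

lemma memLp_snd_mul {f : ℝ → E3 → ℝ} {a : E3 → ℝ} {T C : ℝ} (hf : MemL2 T f)
    (ha : Continuous a) (hC : ∀ x, |a x| ≤ C) : MemL2 T fun t x => a x * f t x :=
  MemLp.of_le_mul (c := C) hf ((ha.comp continuous_snd).aestronglyMeasurable.mul hf.1)
    (Eventually.of_forall fun p => by
      simp only [Function.uncurry, norm_mul, Real.norm_eq_abs]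
      exact mul_le_mul_of_nonneg_right (hC _) (abs_nonneg _))

/-- A function of class `C⁰([0,T], L²)` that vanishes at `t = 0` is the time integral of its
square integrable weak time derivative. -/
lemma ae_eq_integral_of_hasWeakTimeDeriv {f w : ℝ → E3 → ℝ} {T : ℝ} (hT : 0 < T)
    (hf : MemC0L2 T f) (hf2 : MemL2 T f) (h0 : f 0 =ᵐ[volume] 0) (hw2 : MemL2 T w)
    (hw : HasWeakTimeDeriv T f w) :
    ∀ t ∈ Icc 0 T, ∀ᵐ x, f t x = ∫ s in (0 : ℝ)..t, w s x := by
  have hφ2 : ∀ {φ : E3 → ℝ}, Continuous φ → HasCompactSupport φ →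
      MemLp (fun p : ℝ × E3 => φ p.2) 2 (slabMeasure T) := fun hφ hφc =>
    (hφ.memLp_of_hasCompactSupport hφc).comp_snd _
  have hbdd : ∀ {η : ℝ → ℝ}, Continuous η → HasCompactSupport η → ∃ C, ∀ t, ‖η t‖ ≤ C :=
    fun hη hηc => hηc.exists_bound_of_continuous hη
  have hint : ∀ {h : ℝ → E3 → ℝ} {η : ℝ → ℝ} {φ : E3 → ℝ}, MemL2 T h → Continuous η →
      HasCompactSupport η → Continuous φ → HasCompactSupport φ →
      ∫ p, h p.1 p.2 * (η p.1 * φ p.2) ∂(slabMeasure T)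
        = ∫ t in Ioo 0 T, (∫ x, h t x * φ x) * η t := by
    intro h η φ hh hη hηc hφ hφc
    obtain ⟨C, hC⟩ := hbdd hη hηc
    have hi : Integrable (fun p : ℝ × E3 => (h p.1 p.2 * φ p.2) * η p.1) (slabMeasure T) :=
      (hh.integrable_mul (hφ2 hφ hφc)).mul_bdd (c := C)
        (hη.comp continuous_fst).aestronglyMeasurable (Eventually.of_forall fun p => hC p.1)
    have hre : ∀ p : ℝ × E3, h p.1 p.2 * (η p.1 * φ p.2) = (h p.1 p.2 * φ p.2) * η p.1 :=
      fun p => by ring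
    simp_rw [hre]
    rw [slabMeasure, integral_prod _ hi]
    simp_rw [integral_mul_const]
  -- For fixed `φ`, the pairing of `f t` with `φ` is continuous in time, and test functions `η(t)
  -- φ(x)` identify its weak derivative.
  have hslice : ∀ t ∈ Icc 0 T, ∀ φ : E3 → ℝ, ContDiff ℝ ∞ φ → HasCompactSupport φ →
      ∫ x, f t x * φ x = ∫ s in (0 : ℝ)..t, ∫ x, w s x * φ x := by
    intro t ht φ hφ hφc
    have hφL := hφ.continuous.memLp_of_hasCompactSupport (p := 2) (μ := volume) hφc
    have hn : IntegrableOn (fun s => ∫ x, w s x * φ x) (Ioo 0 T) :=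
      (hw2.integrable_mul (hφ2 hφ.continuous hφc)).integral_prod_left
    have key := sub_eq_integral_of_weak_deriv hT (continuousOn_integral_mul hf hφL) hn ?_ t ht
    · have hz : ∫ x, f 0 x * φ x = 0 := by
        refine integral_eq_zero_of_ae ?_
        filter_upwards [h0] with x hx
        simp [hx]
      rwa [hz, sub_zero] at key
    intro η hη hηc hηT
    have hψ : ContDiff ℝ ∞ fun p : ℝ × E3 => η p.1 * φ p.2 :=
      (hη.comp contDiff_fst).mul (hφ.comp contDiff_snd)
    have hsupp : tsupport (fun p : ℝ × E3 => η p.1 * φ p.2) ⊆ tsupport η ×ˢ tsupport φ := by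
      refine closure_minimal (fun p hp => ?_) ((isClosed_tsupport _).prod (isClosed_tsupport _))
      exact ⟨subset_tsupport _ (left_ne_zero_of_mul hp), subset_tsupport _ (right_ne_zero_of_mul hp)⟩
    have h1 := hw.2.2 _ hψ
      (HasCompactSupport.of_support_subset_isCompact (hηc.isCompact.prod hφc.isCompact)
        ((subset_tsupport _).trans hsupp))
      (hsupp.trans (prod_mono hηT (subset_univ _)))
    have hd : ∀ p : ℝ × E3, fderiv ℝ (fun p : ℝ × E3 => η p.1 * φ p.2) p (1, 0)
        = deriv η p.1 * φ p.2 := by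
      intro p
      have e1 : HasFDerivAt (fun p : ℝ × E3 => η p.1) _ p :=
        ((hη.differentiable (by simp) p.1).hasDerivAt.hasFDerivAt).comp p
        (hasFDerivAt_fst (𝕜 := ℝ) (E := ℝ) (F := E3) (p := p))
      have e2 : HasFDerivAt (fun p : ℝ × E3 => φ p.2) _ p :=
        ((hφ.differentiable (by simp) p.2).hasFDerivAt).comp p
        (hasFDerivAt_snd (𝕜 := ℝ) (E := ℝ) (F := E3) (p := p))
      rw [(e1.fun_mul e2).fderiv]
      simp [mul_comm]
    simp_rw [hd] at h1
    rwa [hint hf2 (hη.continuous_deriv (by simp)) hηc.deriv hφ.continuous hφc,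
      hint hw2 hη.continuous hηc hφ.continuous hφc] at h1
  intro t ht
  have hwt : MemLp (Function.uncurry w) 2 (slabMeasure t) :=
    hw2.mono_measure (slabMeasure_mono ht.2)
  have hprim : ∀ x, ∫ s in (0 : ℝ)..t, w s x = ∫ s in Ioo 0 t, w s x := fun x => by
    rw [intervalIntegral.integral_of_le ht.1, integral_Ioc_eq_integral_Ioo]
  simp_rw [hprim]
  have hφ2t : ∀ {φ : E3 → ℝ}, Continuous φ → HasCompactSupport φ →
      MemLp (fun p : ℝ × E3 => φ p.2) 2 (slabMeasure t) := fun hφ hφc =>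
    (hφ.memLp_of_hasCompactSupport hφc).comp_snd _
  have hloc : LocallyIntegrable (fun x => ∫ s in Ioo 0 t, w s x) volume := by
    rw [locallyIntegrable_iff]
    intro K hK
    have : IsFiniteMeasure ((volume : Measure E3).restrict K) :=
      ⟨by simpa using hK.measure_lt_top⟩
    have hle : (volume.restrict (Ioo 0 t)).prod ((volume : Measure E3).restrict K)
        ≤ slabMeasure t := Measure.prod_mono le_rfl Measure.restrict_le_self
    exact ((hwt.mono_measure hle).integrable (by norm_num)).integral_prod_right
  have hloc' := (hf.2.1 t ht).locallyIntegrable (by norm_num)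
  refine ae_eq_of_integral_contDiff_smul_eq hloc' hloc fun φ hφ hφc => ?_
  have e := hslice t ht φ hφ hφc
  rw [intervalIntegral.integral_of_le ht.1, integral_Ioc_eq_integral_Ioo,
    integral_integral_swap (f := fun s x => w s x * φ x)
      (hwt.integrable_mul (hφ2t hφ.continuous hφc))] at e
  simp_rw [integral_mul_const] at e
  simp_rw [smul_eq_mul, mul_comm (φ _)]
  exact e

/-- The null set of `x` in the hypothesis depends on `t`. Exchanging the quantifiers by Fubini needs
the primitive to be jointly measurable, hence the measurable representative `w'`. -/
lemma ae_ae_eq_integral {f w : ℝ → E3 → ℝ} {T : ℝ} (hf2 : MemL2 T f) (hw2 : MemL2 T w)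
    (h : ∀ t ∈ Icc 0 T, ∀ᵐ x, f t x = ∫ s in (0 : ℝ)..t, w s x) :
    ∀ᵐ x, ∀ᵐ t ∂(volume.restrict (Ioo 0 T)), f t x = ∫ s in (0 : ℝ)..t, w s x := by
  set w' := hw2.1.mk (Function.uncurry w) with hw'
  have hww : ∀ᵐ x : E3, ∀ᵐ t ∂(volume.restrict (Ioo 0 T)), w t x = w' (t, x) :=
    ae_ae_swap_of_ae_prod hw2.1.ae_eq_mk
  have hprim : ∀ᵐ x : E3, ∀ t ∈ Ioo 0 T,
      ∫ s in (0 : ℝ)..t, w s x = ∫ s, (Ioo 0 t).indicator (fun s => w' (s, x)) s := by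
    filter_upwards [hww] with x hx t ht
    rw [intervalIntegral.integral_of_le ht.1.le, integral_Ioc_eq_integral_Ioo,
      integral_indicator measurableSet_Ioo]
    exact integral_congr_ae (ae_restrict_of_ae_restrict_of_subset (Ioo_subset_Ioo_right ht.2.le) hx)
  have hmeas : StronglyMeasurable fun p : ℝ × E3 =>
      ∫ s, (Ioo 0 p.1).indicator (fun s => w' (s, p.2)) s := by
    have : StronglyMeasurable fun z : (ℝ × E3) × ℝ =>
        {z : (ℝ × E3) × ℝ | z.2 ∈ Ioo 0 z.1.1}.indicator (fun z => w' (z.2, z.1.2)) z := by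
      refine StronglyMeasurable.indicator ?_ ?_
      · exact hw2.1.stronglyMeasurable_mk.comp_measurable
          (measurable_snd.prodMk (measurable_snd.comp measurable_fst))
      · exact (measurableSet_lt measurable_const measurable_snd).inter
          (measurableSet_lt measurable_snd (measurable_fst.comp measurable_fst))
    exact this.integral_prod_right'
  have hae : Function.uncurry f =ᵐ[slabMeasure T] fun p : ℝ × E3 =>
      ∫ s, (Ioo 0 p.1).indicator (fun s => w' (s, p.2)) s := by
    refine ae_eq_prod_of_ae_ae hf2.1 hmeas.aestronglyMeasurable ?_
    filter_upwards [ae_restrict_mem measurableSet_Ioo] with t ht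
    filter_upwards [h t (Ioo_subset_Icc_self ht), hprim] with x hx hx'
    exact hx.trans (hx' t ht)
  filter_upwards [ae_ae_swap_of_ae_prod hae, hprim] with x hx hx'
  filter_upwards [hx, ae_restrict_mem measurableSet_Ioo] with t h1 h2
  exact h1.trans (hx' t h2).symm

/-- Energy identity in time, with a bounded continuous weight. -/
lemma integral_weight_mul_sq_eq {f w : ℝ → E3 → ℝ} {a : E3 → ℝ} {T C : ℝ} (hf2 : MemL2 T f)
    (hw2 : MemL2 T w) (h : ∀ t ∈ Icc 0 T, ∀ᵐ x, f t x = ∫ s in (0 : ℝ)..t, w s x)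
    (ha : Continuous a) (hC : ∀ x, |a x| ≤ C) {t : ℝ} (ht : t ∈ Icc 0 T) :
    ∫ x, a x * f t x ^ 2 = 2 * ∫ s in Ioo 0 t, ∫ x, a x * w s x * f s x := by
  have hle := slabMeasure_mono ht.2
  have hwt : MemL2 t w := hw2.mono_measure hle
  have hft : MemL2 t f := hf2.mono_measure hle
  have hint : Integrable (fun p : ℝ × E3 => a p.2 * w p.1 p.2 * f p.1 p.2) (slabMeasure t) :=
    (memLp_snd_mul hwt ha hC).integrable_mul hft
  rw [integral_integral_swap (f := fun s x => a x * w s x * f s x) hint, ← integral_const_mul]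
  refine integral_congr_ae ?_
  filter_upwards [h t ht, ae_ae_eq_integral hf2 hw2 h, memLp_two_ae_right hw2] with x h1 h2 h3
  have hi : IntervalIntegrable (fun s => w s x) volume 0 t := by
    rw [intervalIntegrable_iff_integrableOn_Ioo_of_le ht.1]
    have : IntegrableOn (fun s => w s x) (Ioo 0 T) := h3.integrable (by norm_num)
    exact this.mono_set (Ioo_subset_Ioo_right ht.2)
  rw [h1, sq_integral_eq hi, intervalIntegral.integral_of_le ht.1, integral_Ioc_eq_integral_Ioo,
    mul_left_comm, ← integral_const_mul]
  congr 1
  refine integral_congr_ae ?_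
  filter_upwards [ae_restrict_of_ae_restrict_of_subset (Ioo_subset_Ioo_right ht.2) h2] with s hs
  rw [hs]
  ring

/-! ### Uniqueness and linearity of weak derivatives -/

section WeakDerivatives

lemma HasWeakPartial.ae_eq {i : Fin 3} {f f' g g' : E3 → ℝ} (h : HasWeakPartial i f g)
    (h' : HasWeakPartial i f' g') (hf : f =ᵐ[volume] f') : g =ᵐ[volume] g' := by
  refine ae_eq_of_integral_contDiff_smul_eq h.2.1 h'.2.1 fun φ hφ hφc => ?_
  have e := h.2.2 φ hφ hφc
  have e' := h'.2.2 φ hφ hφc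
  have e2 : ∫ x, f x * fderiv ℝ φ x (EuclideanSpace.single i 1)
      = ∫ x, f' x * fderiv ℝ φ x (EuclideanSpace.single i 1) := by
    refine integral_congr_ae ?_
    filter_upwards [hf] with x hx
    rw [hx]
  simp_rw [smul_eq_mul, mul_comm (φ _)]
  linarith

lemma HasWeakPartial.sub {i : Fin 3} {f f' g g' : E3 → ℝ} (h : HasWeakPartial i f g)
    (h' : HasWeakPartial i f' g') : HasWeakPartial i (f - f') (g - g') := by
  refine ⟨h.1.sub h'.1, h.2.1.sub h'.2.1, fun φ hφ hφc => ?_⟩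
  have hi : ∀ {F ψ : E3 → ℝ}, LocallyIntegrable F volume → Continuous ψ → HasCompactSupport ψ →
      Integrable (fun x => F x * ψ x) volume := fun hF hψ hψc =>
    hF.integrable_smul_right_of_hasCompactSupport hψ hψc
  have hd := (contDiff_pd hφ i).continuous
  have hdc := hasCompactSupport_pd hφc i
  have e := h.2.2 φ hφ hφc
  have e' := h'.2.2 φ hφ hφc
  change ∫ x, f x * pd i φ x = _ at e
  change ∫ x, f' x * pd i φ x = _ at e'
  change ∫ x, (f - f') x * pd i φ x = _
  simp only [Pi.sub_apply, sub_mul]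
  rw [integral_sub (hi h.1 hd hdc) (hi h'.1 hd hdc),
    integral_sub (hi h.2.1 hφ.continuous hφc) (hi h'.2.1 hφ.continuous hφc), e, e']
  ring

variable {T : ℝ}

lemma HasWeakSpaceDeriv.ae_eq {i : Fin 3} {f f' g g' : ℝ → E3 → ℝ}
    (h : HasWeakSpaceDeriv T i f g) (h' : HasWeakSpaceDeriv T i f' g')
    (hf : ∀ᵐ t ∂(volume.restrict (Ioo 0 T)), f t =ᵐ[volume] f' t) :
    ∀ᵐ p ∂(slabMeasure T), g p.1 p.2 = g' p.1 p.2 := by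
  refine ae_eq_prod_of_ae_ae h.1 h'.1 ?_
  filter_upwards [h.2, h'.2, hf] with t h1 h2 h3
  exact h1.ae_eq h2 h3

lemma HasWeakSpaceDeriv.sub {i : Fin 3} {f f' g g' : ℝ → E3 → ℝ}
    (h : HasWeakSpaceDeriv T i f g) (h' : HasWeakSpaceDeriv T i f' g') :
    HasWeakSpaceDeriv T i (f - f') (g - g') := by
  refine ⟨h.1.sub h'.1, ?_⟩
  filter_upwards [h.2, h'.2] with t h1 h2
  exact h1.sub h2

lemma hasWeakSpaceDeriv_zero (i : Fin 3) : HasWeakSpaceDeriv T i 0 0 :=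
  ⟨aestronglyMeasurable_const (b := (0 : ℝ)), Eventually.of_forall fun _ =>
    ⟨locallyIntegrable_zero, locallyIntegrable_zero, fun φ _ _ => by simp⟩⟩

lemma integrable_slab_mul {f ψ : ℝ × E3 → ℝ} {K : Set (ℝ × E3)}
    (hf : LocallyIntegrableOn f (Ioo 0 T ×ˢ univ) volume) (hψ : Continuous ψ) (hK : IsCompact K)
    (hKT : K ⊆ Ioo 0 T ×ˢ univ) (h0 : ∀ p ∉ K, ψ p = 0) :
    Integrable (fun p => f p * ψ p) (slabMeasure T) := by
  have h1 : IntegrableOn (fun p => f p * ψ p) K volume :=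
    (hf.integrableOn_compact_subset hKT hK).mul_continuousOn hψ.continuousOn hK
  have h2 : Integrable (fun p => f p * ψ p) volume := by
    rwa [integrableOn_iff_integrable_of_support_subset] at h1
    intro p hp
    by_contra h
    exact hp (by simp [h0 p h])
  rw [slabMeasure_eq_restrict]
  exact h2.restrict

lemma integrable_slab_mul_test {f ψ : ℝ × E3 → ℝ}
    (hf : LocallyIntegrableOn f (Ioo 0 T ×ˢ univ) volume) (hψ : Continuous ψ)
    (hψc : HasCompactSupport ψ) (hψT : tsupport ψ ⊆ Ioo 0 T ×ˢ univ) :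
    Integrable (fun p => f p * ψ p) (slabMeasure T) :=
  integrable_slab_mul hf hψ hψc.isCompact hψT fun _ hp => image_eq_zero_of_notMem_tsupport hp

lemma integrable_slab_mul_fderiv {f ψ : ℝ × E3 → ℝ}
    (hf : LocallyIntegrableOn f (Ioo 0 T ×ˢ univ) volume) (hψ : ContDiff ℝ ∞ ψ)
    (hψc : HasCompactSupport ψ) (hψT : tsupport ψ ⊆ Ioo 0 T ×ˢ univ) :
    Integrable (fun p => f p * fderiv ℝ ψ p (1, 0)) (slabMeasure T) := by
  refine integrable_slab_mul hf ((hψ.continuous_fderiv (by simp)).clm_apply continuous_const)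
    hψc.isCompact hψT fun p hp => ?_
  have : fderiv ℝ ψ p = 0 := by
    by_contra h
    exact hp (support_fderiv_subset ℝ (f := ψ) h)
  simp [this]

lemma HasWeakTimeDeriv.sub {f f' g g' : ℝ → E3 → ℝ} (h : HasWeakTimeDeriv T f g)
    (h' : HasWeakTimeDeriv T f' g') : HasWeakTimeDeriv T (f - f') (g - g') := by
  refine ⟨h.1.sub h'.1, h.2.1.sub h'.2.1, fun ψ hψ hψc hψT => ?_⟩
  have e := h.2.2 ψ hψ hψc hψT
  have e' := h'.2.2 ψ hψ hψc hψT
  simp only [Pi.sub_apply, sub_mul]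
  have i1 := integrable_slab_mul_fderiv h.1 hψ hψc hψT
  have i2 := integrable_slab_mul_fderiv h'.1 hψ hψc hψT
  have i3 := integrable_slab_mul_test h.2.1 hψ.continuous hψc hψT
  have i4 := integrable_slab_mul_test h'.2.1 hψ.continuous hψc hψT
  simp only [Function.uncurry] at i1 i2 i3 i4
  rw [integral_sub i1 i2, integral_sub i3 i4, e, e']
  ring

lemma hasWeakTimeDeriv_zero : HasWeakTimeDeriv T 0 0 :=
  ⟨locallyIntegrable_zero.locallyIntegrableOn _, locallyIntegrable_zero.locallyIntegrableOn _,
    fun ψ _ _ _ => by simp⟩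

lemma HasWeakTimeDeriv.ae_eq {f f' g g' : ℝ → E3 → ℝ} (h : HasWeakTimeDeriv T f g)
    (h' : HasWeakTimeDeriv T f' g') (hf : ∀ᵐ p ∂(slabMeasure T), f p.1 p.2 = f' p.1 p.2) :
    ∀ᵐ p ∂(slabMeasure T), g p.1 p.2 = g' p.1 p.2 := by
  have hU : IsOpen (Ioo 0 T ×ˢ univ : Set (ℝ × E3)) := isOpen_Ioo.prod isOpen_univ
  have hs := h.sub h'
  have key := hU.ae_eq_zero_of_integral_contDiff_smul_eq_zero hs.2.1 fun ψ hψ hψc hψT => ?_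
  · rw [slabMeasure_eq_restrict, ae_restrict_iff' hU.measurableSet]
    filter_upwards [key] with p hp hpU
    exact sub_eq_zero.1 (hp hpU)
  · have e := hs.2.2 ψ hψ hψc hψT
    have e0 : ∫ p, (f - f') p.1 p.2 * fderiv ℝ ψ p (1, 0) ∂(slabMeasure T) = 0 := by
      refine integral_eq_zero_of_ae ?_
      filter_upwards [hf] with p hp
      simp [hp]
    rw [e0, eq_comm, neg_eq_zero, slabMeasure_eq_restrict,
      setIntegral_eq_integral_of_forall_compl_eq_zero] at e
    · rw [← e]
      congr 1
      ext p
      simp [Function.uncurry, mul_comm]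
    · intro p hp
      rw [image_eq_zero_of_notMem_tsupport fun h' => hp (hψT h'), mul_zero]

lemma MemC0L2.sub {f f' : ℝ → E3 → ℝ} (h : MemC0L2 T f) (h' : MemC0L2 T f') :
    MemC0L2 T (f - f') := by
  refine ⟨h.1.sub h'.1, fun t ht => (h.2.1 t ht).sub (h'.2.1 t ht), fun t ht => ?_⟩
  have hlim := (h.2.2 t ht).add (h'.2.2 t ht)
  rw [add_zero] at hlim
  refine tendsto_of_tendsto_of_tendsto_of_le_of_le' tendsto_const_nhds hlim
    (Eventually.of_forall fun _ => zero_le) ?_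
  filter_upwards [self_mem_nhdsWithin] with s hs
  have : (f - f') s - (f - f') t = (f s - f t) - (f' s - f' t) := by
    simp only [Pi.sub_apply]
    abel
  rw [this]
  exact eLpNorm_sub_le ((h.2.1 s hs).sub (h.2.1 t ht)).1 ((h'.2.1 s hs).sub (h'.2.1 t ht)).1
    (by norm_num)

lemma MemC0L2.comp {u : ℝ → E3 → E3} (h : MemC0L2 T u) (k : Fin 3) : MemC0L2 T (comp u k) := by
  have hc : Continuous fun x : E3 => x k := by fun_prop
  refine ⟨hc.comp_aestronglyMeasurable h.1, fun t ht => ?_, fun t ht => ?_⟩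
  · exact (h.2.1 t ht).mono (hc.comp_aestronglyMeasurable (h.2.1 t ht).1)
      (Eventually.of_forall fun x => PiLp.norm_apply_le _ _)
  · refine tendsto_of_tendsto_of_tendsto_of_le_of_le tendsto_const_nhds (h.2.2 t ht)
      (fun _ => zero_le) fun s => eLpNorm_mono fun x => ?_
    exact PiLp.norm_apply_le (u s x - u t x) k

/-- Continuity bounds the spatial norm near each time, compactness of `[0,T]` makes the bound
uniform, and Tonelli concludes. -/
lemma MemC0L2.memL2 {f : ℝ → E3 → ℝ} (h : MemC0L2 T f) : MemL2 T f := by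
  obtain ⟨C, hC, hb⟩ : ∃ C : ENNReal, C ≠ ⊤ ∧ ∀ s ∈ Icc 0 T, eLpNorm (f s) 2 volume ≤ C := by
    refine IsCompact.induction_on (p := fun S => ∃ C : ENNReal, C ≠ ⊤ ∧
      ∀ s ∈ S, eLpNorm (f s) 2 volume ≤ C) (isCompact_Icc (a := (0 : ℝ)) (b := T)) ?_ ?_ ?_ ?_
    · exact ⟨0, by simp, by simp⟩
    · rintro S S' hS ⟨C, hC, h⟩
      exact ⟨C, hC, fun s hs => h s (hS hs)⟩
    · rintro S S' ⟨C, hC, h⟩ ⟨C', hC', h'⟩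
      refine ⟨max C C', by simp [hC, hC'], fun s hs => ?_⟩
      rcases hs with hs | hs
      · exact (h s hs).trans (le_max_left _ _)
      · exact (h' s hs).trans (le_max_right _ _)
    · intro t ht
      refine ⟨{s | s ∈ Icc 0 T ∧ eLpNorm (f s - f t) 2 volume < 1}, ?_,
        1 + eLpNorm (f t) 2 volume, ENNReal.add_ne_top.2 ⟨by simp, (h.2.1 t ht).eLpNorm_ne_top⟩, ?_⟩
      · exact inter_mem self_mem_nhdsWithin ((h.2.2 t ht).eventually (gt_mem_nhds one_pos))
      · rintro s ⟨hs, hs1⟩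
        have := eLpNorm_add_le ((h.2.1 s hs).sub (h.2.1 t ht)).1 (h.2.1 t ht).1 (p := 2)
          (by norm_num)
        rw [sub_add_cancel] at this
        exact this.trans (add_le_add_left hs1.le _)
  refine ⟨h.1, ?_⟩
  rw [eLpNorm_lt_top_iff_lintegral_rpow_enorm_lt_top (by simp) (by simp), slabMeasure,
    lintegral_prod _ (h.1.enorm.pow_const _)]
  have hle : ∀ t ∈ Ioo 0 T, ∫⁻ x, ‖f t x‖ₑ ^ (2 : ENNReal).toReal ≤ C ^ (2 : ℝ) := by
    intro t ht
    have := hb t (Ioo_subset_Icc_self ht)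
    rw [eLpNorm_eq_lintegral_rpow_enorm_toReal (by simp) (by simp), one_div,
      ENNReal.rpow_inv_le_iff (by simp)] at this
    simpa using this
  refine (setLIntegral_mono measurable_const hle).trans_lt ?_
  rw [setLIntegral_const]
  exact ENNReal.mul_lt_top (ENNReal.rpow_lt_top_of_nonneg (by norm_num) hC) (by simp)

end WeakDerivatives

/-! ### Bounds on the profile and Grönwall's inequality -/

lemma IsSteadyProfile.exists_bounds {ρ : ℝ → ℝ} (hρ : IsSteadyProfile ρ) :
    ∃ C, (∀ s, |ρ s| ≤ C) ∧ ∀ s, |deriv ρ s| ≤ C := by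
  have hc : Continuous (deriv ρ) := hρ.smooth.continuous_deriv (by simp)
  obtain ⟨M, hM⟩ := hρ.compact_deriv.exists_bound_of_continuous hc
  have hi : Integrable (deriv ρ) volume := hc.integrable_of_hasCompactSupport hρ.compact_deriv
  refine ⟨max M (|ρ 0| + ∫ s, ‖deriv ρ s‖), fun s => le_trans ?_ (le_max_right _ _),
    fun s => (hM s).trans (le_max_left _ _)⟩
  have h1 : ∫ t in (0 : ℝ)..s, deriv ρ t = ρ s - ρ 0 :=
    intervalIntegral.integral_deriv_eq_sub (fun x _ => hρ.smooth.differentiable (by simp) x)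
      (hc.intervalIntegrable _ _)
  have h2 : |∫ t in (0 : ℝ)..s, deriv ρ t| ≤ ∫ s, ‖deriv ρ s‖ := by
    rw [← Real.norm_eq_abs]
    exact intervalIntegral.norm_integral_le_integral_norm_uIoc.trans
      (setIntegral_le_integral hi.norm (Eventually.of_forall fun _ => norm_nonneg _))
  have h3 : ρ s = ρ 0 + ∫ t in (0 : ℝ)..s, deriv ρ t := by rw [h1]; ring
  rw [h3]
  exact (abs_add_le _ _).trans (by gcongr)

/-- Grönwall's inequality in integral form, with zero initial value. -/
lemma eq_zero_of_le_const_mul_integral {E : ℝ → ℝ} {T K : ℝ} (hT : 0 < T) (hK : 0 ≤ K)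
    (hE0 : ∀ t, 0 ≤ E t) (hE : IntegrableOn E (Ioo 0 T))
    (h : ∀ t ∈ Icc 0 T, E t ≤ K * ∫ s in Ioo 0 t, E s) : ∀ t ∈ Icc 0 T, E t = 0 := by
  have hset : ∀ t, 0 ≤ t → ∫ s in (0 : ℝ)..t, E s = ∫ s in Ioo 0 t, E s := fun t ht => by
    rw [intervalIntegral.integral_of_le ht, integral_Ioc_eq_integral_Ioo]
  set F : ℝ → ℝ := fun t => ∫ s in (0 : ℝ)..t, E s with hF
  have hFc : ContinuousOn F (Icc 0 T) := by
    have := intervalIntegral.continuousOn_primitive_interval (a := 0) (b := T) (f := E)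
      (μ := volume) (by rw [uIcc_of_le hT.le, integrableOn_Icc_iff_integrableOn_Ioo]; exact hE)
    rwa [uIcc_of_le hT.le] at this
  have hF0 : ∀ t ∈ Icc 0 T, 0 ≤ F t := fun t ht =>
    intervalIntegral.integral_nonneg ht.1 fun s _ => hE0 s
  have hEF : ∀ t ∈ Icc 0 T, E t ≤ K * F t := fun t ht => by
    simpa only [hF, hset t ht.1] using h t ht
  have hFi : ∀ t ∈ Icc 0 T, IntervalIntegrable F volume 0 t := fun t ht =>
    (hFc.mono (by rw [uIcc_of_le ht.1]; exact Icc_subset_Icc_right ht.2)).intervalIntegrable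
  -- `E` is only integrable, so `F` need not be differentiable at every point; its primitive `Φ` has
  -- right derivative `F ≤ K Φ` everywhere on `[0,T)`.
  set Φ : ℝ → ℝ := fun t => ∫ s in (0 : ℝ)..t, F s with hΦ
  have hFΦ : ∀ t ∈ Icc 0 T, F t ≤ K * Φ t := by
    intro t ht
    rw [hΦ, ← intervalIntegral.integral_const_mul]
    refine intervalIntegral.integral_mono_on ht.1 ?_ ((hFi t ht).const_mul K) fun s hs =>
      hEF s ⟨hs.1, hs.2.trans ht.2⟩
    rw [intervalIntegrable_iff_integrableOn_Ioo_of_le ht.1]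
    exact hE.mono_set (Ioo_subset_Ioo_right ht.2)
  have hΦc : ContinuousOn Φ (Icc 0 T) := by
    have := intervalIntegral.continuousOn_primitive_interval (a := 0) (b := T) (f := F)
      (μ := volume) (by rw [uIcc_of_le hT.le]; exact hFc.integrableOn_Icc)
    rwa [uIcc_of_le hT.le] at this
  have hΦd : ∀ t ∈ Ico 0 T, HasDerivWithinAt Φ (F t) (Ici t) t := by
    intro t ht
    have hIcc : Icc 0 T ∈ 𝓝[Ioi t] t :=
      mem_of_superset (Ioo_mem_nhdsGT ht.2) fun s hs => ⟨ht.1.trans hs.1.le, hs.2.le⟩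
    have hIcc' : Icc 0 T ∈ 𝓝[Ici t] t :=
      mem_of_superset (Ico_mem_nhdsGE ht.2) fun s hs => ⟨ht.1.trans hs.1, hs.2.le⟩
    have hcw : ContinuousWithinAt F (Ici t) t :=
      (hFc t ⟨ht.1, ht.2.le⟩).mono_of_mem_nhdsWithin hIcc'
    exact intervalIntegral.integral_hasDerivWithinAt_right (hFi t ⟨ht.1, ht.2.le⟩)
      ⟨_, hIcc, hFc.aestronglyMeasurable measurableSet_Icc⟩
      (hcw.mono Ioi_subset_Ici_self)
  have hΦ0 : ∀ t ∈ Icc 0 T, Φ t ≤ 0 := by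
    intro t ht
    have := le_gronwallBound_of_liminf_deriv_right_le (f := Φ) (f' := F) (δ := 0) (K := K) (ε := 0)
      hΦc (fun x hx r hr => (hΦd x hx).liminf_right_slope_le hr) (by simp [hΦ])
      (fun x hx => by simpa using hFΦ x ⟨hx.1, hx.2.le⟩) t ht
    simpa [gronwallBound_ε0_δ0] using this
  intro t ht
  refine le_antisymm ?_ (hE0 t)
  have h1 := mul_nonpos_of_nonneg_of_nonpos hK (hΦ0 t ht)
  have h2 := (hFΦ t ht).trans h1
  exact (hEF t ht).trans (mul_nonpos_of_nonneg_of_nonpos hK h2)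

/-! ### The energy estimate for strong solutions -/

/-- A strong solution together with its weak derivatives: `r = ∂ₜϱ`, `w k = ∂ₜ(v k)`, `G k = ∂ₖq`,
`d k i = ∂ᵢ(v k)` and `D k i = ∂ᵢ∂ᵢ(v k)`. -/
structure StrongData (ρ : ℝ → ℝ) (μ g T : ℝ) (ϱ r q : ℝ → E3 → ℝ)
    (v w G : Fin 3 → ℝ → E3 → ℝ) (d D : Fin 3 → Fin 3 → ℝ → E3 → ℝ) : Prop where
  density : MemC0L2 T ϱ
  density_time : HasWeakTimeDeriv T ϱ r
  mass : ∀ᵐ p ∂(slabMeasure T), r p.1 p.2 + deriv ρ (p.2 2) * v 2 p.1 p.2 = 0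
  velocity : ∀ k, MemC0L2 T (v k)
  velocity_time : ∀ k, HasWeakTimeDeriv T (v k) (w k)
  memL2_time : ∀ k, MemL2 T (w k)
  pressure : ∀ k, HasWeakSpaceDeriv T k q (G k)
  velocity_space : ∀ k i, HasWeakSpaceDeriv T i (v k) (d k i)
  memL2_space : ∀ k i, MemL2 T (d k i)
  velocity_space_two : ∀ k i, HasWeakSpaceDeriv T i (d k i) (D k i)
  memL2_space_two : ∀ k i, MemL2 T (D k i)
  momentum : ∀ k, ∀ᵐ p ∂(slabMeasure T),
    ρ (p.2 2) * w k p.1 p.2 + G k p.1 p.2 + g * ϱ p.1 p.2 * (EuclideanSpace.single 2 1 : E3) k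
      = μ * ∑ i, D k i p.1 p.2
  incompressible : ∀ᵐ p ∂(slabMeasure T), ∑ k, d k k p.1 p.2 = 0

/-- The function class and the equations each supply their own weak derivatives; uniqueness almost
everywhere lets one choice serve both. -/
lemma IsStrongSolution.exists_strongData {ρ : ℝ → ℝ} {μ g T : ℝ} {ϱ q : ℝ → E3 → ℝ}
    {u : ℝ → E3 → E3} (h : IsStrongSolution ρ μ g T ϱ u q) :
    ∃ r w G d D, StrongData ρ μ g T ϱ r q (fun k => comp u k) w G d D := by
  obtain ⟨r, hr, hmass⟩ := h.mass
  choose w hw hw2 using h.memClass.velocity_time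
  choose w' G D' hw' hG hD' hmom using h.momentum
  choose d' hd' hD' using hD'
  obtain ⟨Δ, hΔ, hdiv⟩ := h.incompressible
  have hH := h.memClass.velocity_H2
  choose d hd hd2 using fun k => (hH k).2
  choose D hD hD2 using fun k i => (hd2 k i).2 i
  refine ⟨r, w, G, d, D, h.memClass.density, hr, hmass, fun k => h.memClass.velocity.comp k, hw,
    hw2, hG, hd, fun k i => (hd2 k i).1, hD, hD2, fun k => ?_, ?_⟩
  · have e1 := (hw k).ae_eq (hw' k) (Eventually.of_forall fun _ => rfl)
    have e2 : ∀ i, ∀ᵐ p ∂(slabMeasure T), D k i p.1 p.2 = D' k i p.1 p.2 := fun i => by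
      refine (hD k i).ae_eq (hD' k i) ?_
      filter_upwards [(hd k i).2, (hd' k i).2] with t h1 h2
      exact h1.ae_eq h2 (ae_eq_refl _)
    filter_upwards [hmom k, e1, ae_all_iff.2 e2] with p h1 h2 h3
    rw [h2, h1]
    simp only [h3]
  · have e : ∀ k, ∀ᵐ p ∂(slabMeasure T), d k k p.1 p.2 = Δ k p.1 p.2 := fun k =>
      (hd k k).ae_eq (hΔ k) (Eventually.of_forall fun _ => ae_eq_refl _)
    filter_upwards [hdiv, ae_all_iff.2 e] with p h1 h2
    simp only [h2, h1]

namespace StrongData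

variable {ρ : ℝ → ℝ} {μ g T : ℝ} {ϱ ϱ' r r' q q' : ℝ → E3 → ℝ} {v v' w w' G G' : Fin 3 → ℝ → E3 → ℝ}
  {d d' D D' : Fin 3 → Fin 3 → ℝ → E3 → ℝ}

lemma sub (h : StrongData ρ μ g T ϱ r q v w G d D) (h' : StrongData ρ μ g T ϱ' r' q' v' w' G' d' D') :
    StrongData ρ μ g T (ϱ - ϱ') (r - r') (q - q') (v - v') (w - w') (G - G') (d - d') (D - D') where
  density := h.density.sub h'.density
  density_time := h.density_time.sub h'.density_time
  mass := by
    filter_upwards [h.mass, h'.mass] with p h1 h2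
    simp only [Pi.sub_apply]
    linear_combination h1 - h2
  velocity k := (h.velocity k).sub (h'.velocity k)
  velocity_time k := (h.velocity_time k).sub (h'.velocity_time k)
  memL2_time k := MemLp.sub (h.memL2_time k) (h'.memL2_time k)
  pressure k := (h.pressure k).sub (h'.pressure k)
  velocity_space k i := (h.velocity_space k i).sub (h'.velocity_space k i)
  memL2_space k i := MemLp.sub (h.memL2_space k i) (h'.memL2_space k i)
  velocity_space_two k i := (h.velocity_space_two k i).sub (h'.velocity_space_two k i)
  memL2_space_two k i := MemLp.sub (h.memL2_space_two k i) (h'.memL2_space_two k i)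
  momentum k := by
    filter_upwards [h.momentum k, h'.momentum k] with p h1 h2
    simp only [Pi.sub_apply, Finset.sum_sub_distrib]
    linear_combination h1 - h2
  incompressible := by
    filter_upwards [h.incompressible, h'.incompressible] with p h1 h2
    simp only [Pi.sub_apply, Finset.sum_sub_distrib, h1, h2, sub_zero]

/-- The class gives only local integrability in space; solving the momentum equation for the
pressure gradient gives a global bound. -/
lemma memL2_pressure (h : StrongData ρ μ g T ϱ r q v w G d D) (hρ : Continuous ρ) {C : ℝ}
    (hC : ∀ s, |ρ s| ≤ C) (k : Fin 3) : MemL2 T (G k) := by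
  have h1 : MemLp (fun p : ℝ × E3 => ρ (p.2 2) * w k p.1 p.2) 2 (slabMeasure T) :=
    memLp_snd_mul (a := fun x => ρ (x 2)) (h.memL2_time k) (hρ.comp (by fun_prop)) fun x => hC _
  have h2 : MemLp (fun p : ℝ × E3 =>
      g * (EuclideanSpace.single 2 1 : E3) k * ϱ p.1 p.2) 2 (slabMeasure T) :=
    MemLp.const_mul (f := fun p : ℝ × E3 => ϱ p.1 p.2) h.density.memL2 _
  have h3 : MemLp (fun p : ℝ × E3 => ∑ i, D k i p.1 p.2) 2 (slabMeasure T) :=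
    memLp_finsetSum (f := fun i (p : ℝ × E3) => D k i p.1 p.2) _ fun i _ => h.memL2_space_two k i
  refine MemLp.ae_eq ?_ (((h3.const_mul μ).sub h1).sub h2)
  filter_upwards [h.momentum k] with p hp
  simp only [Pi.sub_apply, Function.uncurry]
  linear_combination -hp

/-- The spatial energy estimate at almost every time. -/
lemma ae_sum_integral_le (h : StrongData ρ μ g T ϱ r q v w G d D) (hρ : Continuous ρ) {C : ℝ}
    (hC : ∀ s, |ρ s| ≤ C) (hμ : 0 < μ) :
    ∀ᵐ t ∂(volume.restrict (Ioo 0 T)),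
      ∑ k, ∫ x, ρ (x 2) * w k t x * v k t x ≤ - (g * ∫ x, ϱ t x * v 2 t x) := by
  have hv2 : ∀ k, MemL2 T (v k) := fun k => (h.velocity k).memL2
  have hG2 := h.memL2_pressure hρ hC
  filter_upwards [memLp_two_ae_left h.density.memL2, ae_all_iff.2 fun k => memLp_two_ae_left (hv2 k),
    ae_all_iff.2 fun k => memLp_two_ae_left (hG2 k),
    ae_all_iff.2 fun k => ae_all_iff.2 fun i => memLp_two_ae_left (h.memL2_space k i),
    ae_all_iff.2 fun k => ae_all_iff.2 fun i => memLp_two_ae_left (h.memL2_space_two k i),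
    ae_all_iff.2 fun k => (h.pressure k).2,
    ae_all_iff.2 fun k => ae_all_iff.2 fun i => (h.velocity_space k i).2,
    ae_all_iff.2 fun k => ae_all_iff.2 fun i => (h.velocity_space_two k i).2,
    ae_all_iff.2 fun k => Measure.ae_ae_of_ae_prod (h.momentum k),
    Measure.ae_ae_of_ae_prod h.incompressible]
    with t tϱ tv tG td tD tq tvd tdD tmom tdiv
  simp only [Function.uncurry] at tϱ tv tG td tD
  have hpress : ∑ k, ∫ x, G k t x * v k t x = 0 :=
    sum_integral_gradient_mul_eq_zero tq tG (fun k => tvd k k) tv (fun k => td k k) tdiv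
  -- Integration by parts gives minus the integral of `(∂ᵢvₖ)²`.
  have hvisc : ∀ k i, ∫ x, D k i t x * v k t x ≤ 0 := fun k i => by
    rw [(tdD k i).integral_mul_eq_neg (tvd k i) (td k i) (tD k i) (tv k) (td k i), neg_nonpos]
    exact integral_nonneg fun x => mul_self_nonneg _
  have hk : ∀ k, ∫ x, ρ (x 2) * w k t x * v k t x
      = μ * (∑ i, ∫ x, D k i t x * v k t x) - (∫ x, G k t x * v k t x)
        - g * (EuclideanSpace.single 2 1 : E3) k * ∫ x, ϱ t x * v k t x := by
    intro k
    have i1 : ∀ i, Integrable (fun x => D k i t x * v k t x) volume := fun i =>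
      (tD k i).integrable_mul (tv k)
    have i2 : Integrable (fun x => G k t x * v k t x) volume := (tG k).integrable_mul (tv k)
    have i3 : Integrable (fun x => ϱ t x * v k t x) volume := tϱ.integrable_mul (tv k)
    have i4 : Integrable (fun x => μ * ∑ i, D k i t x * v k t x) volume :=
      (integrable_finsetSum _ fun i _ => i1 i).const_mul μ
    have i5 : Integrable (fun x => μ * (∑ i, D k i t x * v k t x) - G k t x * v k t x) volume :=
      i4.sub i2
    rw [← integral_finsetSum _ fun i _ => i1 i, ← integral_const_mul, ← integral_const_mul,
      ← integral_sub i4 i2, ← integral_sub i5 (i3.const_mul _)]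
    refine integral_congr_ae ?_
    filter_upwards [tmom k] with x hx
    rw [← Finset.sum_mul]
    linear_combination v k t x * hx
  simp_rw [hk]
  rw [Finset.sum_sub_distrib, Finset.sum_sub_distrib, hpress, ← Finset.mul_sum]
  have hsum : ∑ k, g * (EuclideanSpace.single 2 1 : E3) k * ∫ x, ϱ t x * v k t x
      = g * ∫ x, ϱ t x * v 2 t x := by
    simp
  rw [hsum]
  have := mul_nonpos_of_nonneg_of_nonpos hμ.le
    (Finset.sum_nonpos fun k (_ : k ∈ Finset.univ) =>
      Finset.sum_nonpos fun i (_ : i ∈ Finset.univ) => hvisc k i)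
  linarith

/-- A strong solution with zero initial values has zero density and velocity. -/
theorem eq_zero (h : StrongData ρ μ g T ϱ r q v w G d D) (hρ : IsSteadyProfile ρ) (hμ : 0 < μ)
    (hg : 0 < g) (hT : 0 < T) (hϱ0 : ϱ 0 =ᵐ[volume] 0) (hv0 : ∀ k, v k 0 =ᵐ[volume] 0) :
    ∀ t ∈ Icc 0 T, ϱ t =ᵐ[volume] 0 ∧ ∀ k, v k t =ᵐ[volume] 0 := by
  obtain ⟨C, hC, hC'⟩ := hρ.exists_bounds
  obtain ⟨c, hc, hcρ⟩ := hρ.inf_pos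
  have hC0 : 0 ≤ C := (abs_nonneg _).trans (hC 0)
  have hρc : Continuous fun x : E3 => ρ (x 2) := hρ.smooth.continuous.comp (by fun_prop)
  have hρc' : Continuous fun x : E3 => deriv ρ (x 2) :=
    (hρ.smooth.continuous_deriv (by simp)).comp (by fun_prop)
  have hv2 : ∀ k, MemL2 T (v k) := fun k => (h.velocity k).memL2
  have hϱ2 : MemL2 T ϱ := h.density.memL2
  -- The mass equation expresses `r` as a bounded multiple of `v 2`.
  have hr2 : MemL2 T r := by
    refine MemLp.ae_eq ?_ (memLp_snd_mul (hv2 2) hρc' fun x => hC' _).neg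
    filter_upwards [h.mass] with p hp
    simp only [Pi.neg_apply, Function.uncurry]
    linear_combination -hp
  have hvw := fun k => ae_eq_integral_of_hasWeakTimeDeriv hT (h.velocity k) (hv2 k) (hv0 k)
    (h.memL2_time k) (h.velocity_time k)
  have hϱr := ae_eq_integral_of_hasWeakTimeDeriv hT h.density hϱ2 hϱ0 hr2 h.density_time
  set E : ℝ → ℝ := fun t => (∑ k, ∫ x, ρ (x 2) * v k t x ^ 2) + ∫ x, 1 * ϱ t x ^ 2 with hEdef
  have hnn : ∀ t k, 0 ≤ ∫ x, ρ (x 2) * v k t x ^ 2 := fun t k =>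
    integral_nonneg fun x => mul_nonneg (hc.le.trans (hcρ _)) (sq_nonneg _)
  have hnnϱ : ∀ t, 0 ≤ ∫ x, 1 * ϱ t x ^ 2 := fun t =>
    integral_nonneg fun x => mul_nonneg zero_le_one (sq_nonneg _)
  have hE0 : ∀ t, 0 ≤ E t := fun t => add_nonneg (Finset.sum_nonneg fun k _ => hnn t k) (hnnϱ t)
  have hsqi : ∀ k, Integrable (fun p : ℝ × E3 => ρ (p.2 2) * v k p.1 p.2 ^ 2) (slabMeasure T) :=
    fun k => (hv2 k).integrable_sq.bdd_mul (c := C)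
      (hρc.comp continuous_snd).aestronglyMeasurable (Eventually.of_forall fun p => hC _)
  have hsqϱ : Integrable (fun p : ℝ × E3 => 1 * ϱ p.1 p.2 ^ 2) (slabMeasure T) := by
    simpa [Function.uncurry] using hϱ2.integrable_sq
  have hE : IntegrableOn E (Ioo 0 T) :=
    (integrable_finsetSum _ fun k _ => (hsqi k).integral_prod_left).add hsqϱ.integral_prod_left
  -- The factor `g + C` bounds `|g + ρ'|`; `1 + c⁻¹` comes from `2 |ϱ v₃| ≤ v₃² + ϱ²` and `v₃² ≤ c⁻¹
  -- ρ v₃²`.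
  set K : ℝ := (g + C) * (1 + c⁻¹) with hK
  have hK0 : 0 ≤ K := by positivity
  have hwvi : ∀ k, Integrable (fun p : ℝ × E3 => ρ (p.2 2) * w k p.1 p.2 * v k p.1 p.2)
      (slabMeasure T) := fun k =>
    (memLp_snd_mul (a := fun x => ρ (x 2)) (h.memL2_time k) hρc fun x => hC _).integrable_mul (hv2 k)
  have hrϱi : Integrable (fun p : ℝ × E3 => 1 * r p.1 p.2 * ϱ p.1 p.2) (slabMeasure T) := by
    simp only [one_mul]
    exact hr2.integrable_mul hϱ2
  have hrate : ∀ᵐ s ∂(volume.restrict (Ioo 0 T)),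
      2 * ((∑ k, ∫ x, ρ (x 2) * w k s x * v k s x) + ∫ x, 1 * r s x * ϱ s x) ≤ K * E s := by
    filter_upwards [h.ae_sum_integral_le hρ.smooth.continuous hC hμ, ae_restrict_mem measurableSet_Ioo,
      Measure.ae_ae_of_ae_prod h.mass, (hsqi 2).prod_right_ae] with s hs hsT hmass hsq
    have hsϱ := h.density.2.1 s (Ioo_subset_Icc_self hsT)
    have hsv := (h.velocity 2).2.1 s (Ioo_subset_Icc_self hsT)
    have i1 : Integrable (fun x => ϱ s x * v 2 s x) volume := hsϱ.integrable_mul hsv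
    have i2 : Integrable (fun x => 1 * ϱ s x ^ 2) volume := by simpa using hsϱ.integrable_sq
    have i3 : Integrable (fun x => deriv ρ (x 2) * (ϱ s x * v 2 s x)) volume :=
      i1.bdd_mul (c := C) hρc'.aestronglyMeasurable (Eventually.of_forall fun x => hC' _)
    have e1 : ∫ x, 1 * r s x * ϱ s x = - ∫ x, deriv ρ (x 2) * (ϱ s x * v 2 s x) := by
      rw [← integral_neg]
      refine integral_congr_ae ?_
      filter_upwards [hmass] with x hx
      linear_combination ϱ s x * hx
    have i4 : Integrable (fun x => (1 + c⁻¹) * (ρ (x 2) * v 2 s x ^ 2 + 1 * ϱ s x ^ 2)) volume :=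
      (hsq.add i2).const_mul _
    have e2 : ∫ x, -(2 * (g * (ϱ s x * v 2 s x) + deriv ρ (x 2) * (ϱ s x * v 2 s x)))
        ≤ ∫ x, (g + C) * ((1 + c⁻¹) * (ρ (x 2) * v 2 s x ^ 2 + 1 * ϱ s x ^ 2)) := by
      refine integral_mono (((i1.const_mul g).add i3).const_mul 2).neg (i4.const_mul _) fun x => ?_
      have a1 : |g + deriv ρ (x 2)| ≤ g + C :=
        (abs_add_le _ _).trans (by rw [abs_of_pos hg]; gcongr; exact hC' _)
      have a2 : v 2 s x ^ 2 ≤ c⁻¹ * (ρ (x 2) * v 2 s x ^ 2) := by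
        rw [inv_mul_eq_div, le_div_iff₀ hc, mul_comm]
        exact mul_le_mul_of_nonneg_right (hcρ _) (sq_nonneg _)
      have a3 : 0 ≤ ρ (x 2) * v 2 s x ^ 2 := mul_nonneg (hc.le.trans (hcρ _)) (sq_nonneg _)
      have a4 : |2 * (ϱ s x * v 2 s x)| ≤ (1 + c⁻¹) * (ρ (x 2) * v 2 s x ^ 2 + 1 * ϱ s x ^ 2) := by
        have b1 : |2 * (ϱ s x * v 2 s x)| ≤ v 2 s x ^ 2 + ϱ s x ^ 2 := by
          rw [abs_le]
          constructor <;> nlinarith [sq_nonneg (v 2 s x + ϱ s x), sq_nonneg (v 2 s x - ϱ s x)]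
        have b2 : 0 ≤ c⁻¹ * ϱ s x ^ 2 := by positivity
        linarith
      calc -(2 * (g * (ϱ s x * v 2 s x) + deriv ρ (x 2) * (ϱ s x * v 2 s x)))
          = -((g + deriv ρ (x 2)) * (2 * (ϱ s x * v 2 s x))) := by ring
        _ ≤ |(g + deriv ρ (x 2)) * (2 * (ϱ s x * v 2 s x))| := neg_le_abs _
        _ = |g + deriv ρ (x 2)| * |2 * (ϱ s x * v 2 s x)| := abs_mul _ _
        _ ≤ _ := mul_le_mul a1 a4 (abs_nonneg _) (by positivity)
    rw [integral_neg, integral_const_mul, integral_add (i1.const_mul g) i3, integral_const_mul,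
      integral_const_mul, integral_const_mul, integral_add hsq i2, ← mul_assoc, ← hK] at e2
    have e3 : (∫ x, ρ (x 2) * v 2 s x ^ 2) + ∫ x, 1 * ϱ s x ^ 2 ≤ E s := by
      have := Finset.single_le_sum (fun k (_ : k ∈ Finset.univ) => hnn s k) (Finset.mem_univ 2)
      simp only [hEdef]
      linarith
    have e4 := mul_le_mul_of_nonneg_left e3 hK0
    linarith
  have hEle : ∀ t ∈ Icc 0 T, E t ≤ K * ∫ s in Ioo 0 t, E s := by
    intro t ht
    have hsub : Ioo 0 t ⊆ Ioo 0 T := Ioo_subset_Ioo_right ht.2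
    have j1 : ∀ k, IntegrableOn (fun s => ∫ x, ρ (x 2) * w k s x * v k s x) (Ioo 0 t) := fun k =>
      IntegrableOn.mono_set (hwvi k).integral_prod_left hsub
    have j2 : IntegrableOn (fun s => ∫ x, 1 * r s x * ϱ s x) (Ioo 0 t) :=
      IntegrableOn.mono_set hrϱi.integral_prod_left hsub
    have j3 : IntegrableOn (fun s => ∑ k, ∫ x, ρ (x 2) * w k s x * v k s x) (Ioo 0 t) :=
      integrable_finsetSum _ fun k _ => j1 k
    have e : E t = ∫ s in Ioo 0 t,
        2 * ((∑ k, ∫ x, ρ (x 2) * w k s x * v k s x) + ∫ x, 1 * r s x * ϱ s x) := by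
      simp only [hEdef]
      rw [integral_weight_mul_sq_eq (a := fun _ => 1) (C := 1) hϱ2 hr2 hϱr continuous_const
        (by simp) ht]
      simp_rw [fun k => integral_weight_mul_sq_eq (a := fun x => ρ (x 2)) (hv2 k) (h.memL2_time k)
        (hvw k) hρc (fun x => hC _) ht]
      rw [integral_const_mul, integral_add j3 j2, integral_finsetSum _ fun k _ => j1 k,
        ← Finset.mul_sum, mul_add]
    rw [e, ← integral_const_mul]
    exact integral_mono_ae ((j3.add j2).const_mul 2) ((hE.mono_set hsub).const_mul K)
      (ae_restrict_of_ae_restrict_of_subset hsub hrate)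
  have hzero := eq_zero_of_le_const_mul_integral hT hK0 hE0 hE hEle
  intro t ht
  have hEt := hzero t ht
  -- A vanishing sum of nonnegative terms has vanishing terms.
  have hz := (add_eq_zero_iff_of_nonneg (Finset.sum_nonneg fun k _ => hnn t k) (hnnϱ t)).1 hEt
  constructor
  · have hi : Integrable (fun x => 1 * ϱ t x ^ 2) volume := by
      simpa using (h.density.2.1 t ht).integrable_sq
    have := (integral_eq_zero_iff_of_nonneg
      (fun x => mul_nonneg zero_le_one (sq_nonneg _)) hi).1 hz.2
    filter_upwards [this] with x hx
    simpa using hx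
  · intro k
    have hk := (Finset.sum_eq_zero_iff_of_nonneg fun k _ => hnn t k).1 hz.1 k (Finset.mem_univ k)
    have hi : Integrable (fun x => ρ (x 2) * v k t x ^ 2) volume :=
      ((h.velocity k).2.1 t ht).integrable_sq.bdd_mul (c := C) hρc.aestronglyMeasurable
        (Eventually.of_forall fun x => hC _)
    have := (integral_eq_zero_iff_of_nonneg
      (fun x => mul_nonneg (hc.le.trans (hcρ _)) (sq_nonneg _)) hi).1 hk
    filter_upwards [this] with x hx
    have hne : ρ (x 2) ≠ 0 := (hc.trans_le (hcρ _)).ne'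
    simpa [hne] using hx

/-- If density and velocity vanish, then so does the pressure gradient. -/
lemma pressure_eq_zero (h : StrongData ρ μ g T ϱ r q v w G d D)
    (h0 : ∀ t ∈ Icc 0 T, ϱ t =ᵐ[volume] 0 ∧ ∀ k, v k t =ᵐ[volume] 0) (k : Fin 3) :
    ∀ᵐ p ∂(slabMeasure T), G k p.1 p.2 = 0 := by
  have hIoo := ae_restrict_mem (μ := (volume : Measure ℝ)) (measurableSet_Ioo (a := 0) (b := T))
  have hϱ : ∀ᵐ p ∂(slabMeasure T), ϱ p.1 p.2 = 0 := by
    refine ae_eq_prod_of_ae_ae h.density.1 (aestronglyMeasurable_const (b := (0 : ℝ))) ?_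
    filter_upwards [hIoo] with t ht
    exact (h0 t (Ioo_subset_Icc_self ht)).1
  have hv : ∀ᵐ p ∂(slabMeasure T), v k p.1 p.2 = 0 := by
    refine ae_eq_prod_of_ae_ae (h.velocity k).1 (aestronglyMeasurable_const (b := (0 : ℝ))) ?_
    filter_upwards [hIoo] with t ht
    exact (h0 t (Ioo_subset_Icc_self ht)).2 k
  have hw := (h.velocity_time k).ae_eq hasWeakTimeDeriv_zero hv
  have hd : ∀ i, ∀ᵐ p ∂(slabMeasure T), d k i p.1 p.2 = 0 := fun i => by
    refine (h.velocity_space k i).ae_eq (hasWeakSpaceDeriv_zero i) ?_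
    filter_upwards [hIoo] with t ht
    exact (h0 t (Ioo_subset_Icc_self ht)).2 k
  have hD : ∀ i, ∀ᵐ p ∂(slabMeasure T), D k i p.1 p.2 = 0 := fun i =>
    (h.velocity_space_two k i).ae_eq (hasWeakSpaceDeriv_zero i)
      (Measure.ae_ae_of_ae_prod (hd i))
  filter_upwards [h.momentum k, hϱ, hw, ae_all_iff.2 hD] with p h1 h2 h3 h4
  simpa [h2, h3, h4] using h1

end StrongData

end LinearizedNS

/-! ### Uniqueness for the difference of two solutions -/

theorem theorem3p1 (ρ : ℝ → ℝ) (hρ : LinearizedNS.IsSteadyProfile ρ)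
    (μ g T : ℝ) (hμ : 0 < μ) (hg : 0 < g) (hT : 0 < T)
    (ϱ₁ ϱ₂ : ℝ → LinearizedNS.E3 → ℝ)
    (u₁ u₂ : ℝ → LinearizedNS.E3 → LinearizedNS.E3)
    (q₁ q₂ : ℝ → LinearizedNS.E3 → ℝ)
    (h₁ : LinearizedNS.IsStrongSolution ρ μ g T ϱ₁ u₁ q₁)
    (h₂ : LinearizedNS.IsStrongSolution ρ μ g T ϱ₂ u₂ q₂)
    (hϱ0 : ϱ₁ 0 =ᵐ[volume] ϱ₂ 0) (hu0 : u₁ 0 =ᵐ[volume] u₂ 0) :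
    (∀ t ∈ Icc 0 T, ϱ₁ t =ᵐ[volume] ϱ₂ t) ∧
    (∀ t ∈ Icc 0 T, u₁ t =ᵐ[volume] u₂ t) ∧
    (∀ (i : Fin 3) (G₁ G₂ : ℝ → LinearizedNS.E3 → ℝ),
      LinearizedNS.HasWeakSpaceDeriv T i q₁ G₁ → LinearizedNS.HasWeakSpaceDeriv T i q₂ G₂ →
      ∀ᵐ p ∂(LinearizedNS.slabMeasure T), G₁ p.1 p.2 = G₂ p.1 p.2) := by
  obtain ⟨r₁, w₁, Γ₁, d₁, D₁, s₁⟩ := h₁.exists_strongData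
  obtain ⟨r₂, w₂, Γ₂, d₂, D₂, s₂⟩ := h₂.exists_strongData
  have s := s₁.sub s₂
  have hz := s.eq_zero hρ hμ hg hT
    (by filter_upwards [hϱ0] with x hx; simp [hx])
    (fun k => by filter_upwards [hu0] with x hx; simp [LinearizedNS.comp, hx])
  refine ⟨fun t ht => ?_, fun t ht => ?_, fun i G₁ G₂ hG₁ hG₂ => ?_⟩
  · filter_upwards [(hz t ht).1] with x hx
    exact sub_eq_zero.1 hx
  · filter_upwards [ae_all_iff.2 (hz t ht).2] with x hx
    ext k
    exact sub_eq_zero.1 (hx k)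
  -- `G₁` and `G₂` are arbitrary weak derivatives, so their difference is first identified with the
  -- one carried by `s`.
  · filter_upwards [(hG₁.sub hG₂).ae_eq (s.pressure i)
      (Eventually.of_forall fun _ => ae_eq_refl _), s.pressure_eq_zero hz i] with p h1 h2
    exact sub_eq_zero.1 (h1.trans h2)
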